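/- Let $\alpha>0$, let $n\ge 1$ be the integer with $n-1<\alpha\le n$, and let $r\in\mathbb R$ satisfy $r\le\alpha$ (if $\alpha=n$ is an integer, $r\in\mathbb R$ is arbitrary). For $u:\mathbb R\to\mathbb R$ the left and right Grünwald–Letnikov derivatives of order $\alpha$ are $${}_{-\infty}D_x^\alpha u(x)=\lim_{h\to0^+}\frac1{h^\alpha}\sum_{k=0}^\infty(-1)^k\binom{\alpha}{k}u(x-kh),\qquad {}_xD_\infty^\alpha u(x)=\lim_{h\to0^+}\frac1{h^\alpha}\sum_{k=0}^\infty(-1)^k\binom{\alpha}{k}u(x+kh).$$ Let $w_{k,r}^{(\alpha)}$ be the Taylor coefficients at $0$ of $$W_{2,r}(z)=\Big(\tfrac32-\tfrac r\alpha+\big(-2+\tfrac{2r}\alpha\big)z+\big(\tfrac12-\tfrac r\alpha\big)z^2\Big)^\alpha=\sum_{k=0}^\infty w_{k,r}^{(\alpha)}z^k ,$$ and for $h>0$ put $$\Delta_{2,+r}^\alpha u(x)=\frac1{h^\alpha}\sum_{k=0}^\infty w_{k,r}^{(\alpha)}u(x-(k-r)h),\qquad \Delta_{2,-r}^\alpha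 u(x)=\frac1{h^\alpha}\sum_{k=0}^\infty w_{k,r}^{(\alpha)}u(x+(k-r)h).$$ Let $$a_2(r)=-\frac\alpha3+r-\frac{r^2}{2\alpha},\qquad P_x=I+a_2(r)h^2D^2,\quad D^2=\frac{d^2}{dx^2},$$ $$P_h=1+a_2(r)h^2\delta_h^2,\qquad \delta_h^2v(x)=\frac{v(x-h)-2v(x)+v(x+h)}{h^2}.$$ (1) The weights are absolutely summable: $\sum_k|w_{k,r}^{(\alpha)}|<\infty$. (2) Let $u\in C^{n+4}(\mathbb R)$ with $u^{(k)}\in L^1(\mathbb R)$ for $0\le k\le n+4$. Then all the series above converge for every $x\in\mathbb R$ and $h>0$, the limits defining ${}_{-\infty}D_x^\alpha u$ and ${}_xD_\infty^\alpha u$ exist at every $x\in\mathbb R$, these two functions are of class $C^2$, and, uniformly in $x\in\mathbb R$ as $h\to0^+$, $$\Delta_{2,+r}^\alpha u(x)=P_x\;{}_{-\infty}D_x^\alpha u(x)+O(h^3),\qquad \Delta_{2,-r}^\alpha u(x)=P_x\;{}_xD_\infty^\alpha u(x)+O(h^3).$$ (3) For every $v\in C^4(\mathbb R)$ and every $x\in\mathbb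 R$, $P_hv(x)=P_xv(x)+O(h^4)$ as $h\to0^+$. If moreover $v^{(4)}$ is bounded, then there is a constant $C$ with $|P_hv(x)-P_xv(x)|\le Ch^4$ for all $h>0$ and all $x\in\mathbb R$. -/

import Mathlib

open Filter Topology Asymptotics

noncomputable section

namespace QuasiCompact

/-- Grünwald weights `g_k = (-1)^k * binom(α, k)`, the Taylor coefficients of `(1 - z)^α`. -/
def glWeight (α : ℝ) (k : ℕ) : ℝ := (-1) ^ k * Ring.choose α k

/-- The left Grünwald difference quotient `h^(-α) ∑ g_k u(x - k h)`. -/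
def leftGLQuotient (α h : ℝ) (u : ℝ → ℝ) (x : ℝ) : ℝ :=
  1 / h ^ α * ∑' k : ℕ, glWeight α k * u (x - k * h)

/-- The right Grünwald difference quotient `h^(-α) ∑ g_k u(x + k h)`. -/
def rightGLQuotient (α h : ℝ) (u : ℝ → ℝ) (x : ℝ) : ℝ :=
  1 / h ^ α * ∑' k : ℕ, glWeight α k * u (x + k * h)

/-- The left Grünwald-Letnikov derivative of order `α` on the line (meaningful where the limit
exists). -/
def leftFracDeriv (α : ℝ) (u : ℝ → ℝ) (x : ℝ) : ℝ :=
  limUnder (𝓝[>] (0 : ℝ)) (fun h => leftGLQuotient α h u x)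

/-- The right Grünwald-Letnikov derivative of order `α` on the line (meaningful where the limit
exists). -/
def rightFracDeriv (α : ℝ) (u : ℝ → ℝ) (x : ℝ) : ℝ :=
  limUnder (𝓝[>] (0 : ℝ)) (fun h => rightGLQuotient α h u x)

/-- The generating function `W_{2,r}(z) = (β₀ + β₁ z + β₂ z²)^α` of order `2` and shift `r`. -/
def genW2 (α r z : ℝ) : ℝ :=
  ((3 / 2 - r / α) + (-2 + 2 * r / α) * z + (1 / 2 - r / α) * z ^ 2) ^ α

/-- The weights: the coefficients of the power series `W_{2,r}(z) = ∑ w_k z^k` at `0`. -/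
def w2 (α r : ℝ) (k : ℕ) : ℝ := iteratedDeriv k (genW2 α r) 0 / (k.factorial : ℝ)

/-- The left operator `Δ_{2,+r}^α u(x) = h^(-α) ∑ w_k u(x - (k - r) h)`. -/
def leftDelta2 (α r h : ℝ) (u : ℝ → ℝ) (x : ℝ) : ℝ :=
  1 / h ^ α * ∑' k : ℕ, w2 α r k * u (x - ((k : ℝ) - r) * h)

/-- The right operator `Δ_{2,-r}^α u(x) = h^(-α) ∑ w_k u(x + (k - r) h)`. -/
def rightDelta2 (α r h : ℝ) (u : ℝ → ℝ) (x : ℝ) : ℝ :=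
  1 / h ^ α * ∑' k : ℕ, w2 α r k * u (x + ((k : ℝ) - r) * h)

/-- The coefficient `a₂(r) = -α/3 + r - r²/(2α)`. -/
def a2 (α r : ℝ) : ℝ := -α / 3 + r - r ^ 2 / (2 * α)

/-- The operator `P_x = I + a₂(r) h² D²`. -/
def Px (α r h : ℝ) (v : ℝ → ℝ) (x : ℝ) : ℝ :=
  v x + a2 α r * h ^ 2 * iteratedDeriv 2 v x

/-- The second order central difference `δ_h² v(x) = (v(x - h) - 2 v(x) + v(x + h)) / h²`. -/
def centralDiff2 (h : ℝ) (v : ℝ → ℝ) (x : ℝ) : ℝ :=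
  1 / h ^ 2 * (v (x - h) - 2 * v x + v (x + h))

/-- The operator `P_h = 1 + a₂(r) h² δ_h²`. -/
def Ph (α r h : ℝ) (v : ℝ → ℝ) (x : ℝ) : ℝ :=
  v x + a2 α r * h ^ 2 * centralDiff2 h v x

end QuasiCompact

end

open Filter Topology Asymptotics

noncomputable section

namespace QuasiCompact

/-! The argument compares Fourier symbols. Since `z = 1` is a root of the quadratic, `W_{2,r}(z) =
(1 - z)^α (c + (1 - c) z)^α` with `c = 3/2 - r/α`. If `r ≤ α` then `c ≥ 1/2`, so the second factor
is a constant times `(1 - q z)^α` with `|q| ≤ 1`. Both factors then have absolutely summable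
coefficients, and so has their Cauchy product. If `α = n`, the second factor is a polynomial and no
condition on `r` is needed (`exists_w2_spec`).

With `s = iy`, the shifted difference operator has symbol `W(e^{-s}) e^{rs}`, which near `0` equals
`s^α exp(α L(s))`, where `L` is the sum of the logarithms of `(1 - e^{-s})/s` and `c + (1 - c)
e^{-s}` plus `(r/α) s`. The linear terms of `L` cancel and its quadratic term, multiplied by `α`, is
`a₂(r) s²`. So the symbol is `s^α (1 + a₂ s²)` up to `O(|y|^(α+3))`. Boundedness of the symbol makes
this bound global (`w2Symbol_bound`). In the same way the Grünwald symbol is `s^α` up to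
`O(|y|^(α+1))`.

For `u` with `n + 4` integrable derivatives, the transform of `u` is `O((1 + |ξ|)^(-(n+4)))`. By
Fourier inversion and the homogeneity of `s^α`, the error is at most `h^3` times the integral of
`|y|^(α+3)` against this transform, uniformly in `x` (`norm_diff_sub_le`). That integral is
controlled only for `α < n`. At `α = n` the weights are finitely supported, and a Taylor expansion
replaces the integral; the symbol bound supplies the moments of the weights (`integer_order_error`).

The right-sided claims follow by the reflection `x ↦ -x`, and the comparison of `P_h` with `P_x` is
a fourth order Taylor expansion. -/

/-! ### Absolute summability of the binomial coefficients. -/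

theorem succ_mul_choose_succ (a : ℝ) (k : ℕ) :
    ((k : ℝ) + 1) * Ring.choose a (k + 1) = (a - k) * Ring.choose a k := by
  have hk : ((k.factorial : ℕ) : ℝ) ≠ 0 := by positivity
  simp only [Ring.choose_eq_smul, descPochhammer_succ_right, Polynomial.smeval_mul,
    Polynomial.smeval_sub, Polynomial.smeval_X, Polynomial.smeval_natCast, Nat.factorial_succ,
    smul_eq_mul]
  push_cast
  simp
  field_simp

/-- Pascal's rule writes the left side as a sum of two consecutive coefficients of order `α - 1`.
Their ratio lies in `[-1, 0]` once `k + 1 ≥ α`, so the absolute values subtract. This makes the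
series of absolute values telescope. -/
theorem abs_choose_succ_eq (α : ℝ) (hα : 0 < α) (k : ℕ) (hk : α ≤ k + 1) :
    |Ring.choose α (k + 1)| = |Ring.choose (α - 1) k| - |Ring.choose (α - 1) (k + 1)| := by
  have h1 := Ring.choose_succ_succ (α - 1) k
  rw [sub_add_cancel] at h1
  have h2 := succ_mul_choose_succ (α - 1) k
  have hk1 : (0 : ℝ) < k + 1 := by positivity
  set t : ℝ := (k + 1 - α) / (k + 1) with ht
  have ht0 : 0 ≤ t := div_nonneg (by linarith) hk1.le
  have ht1 : t ≤ 1 := by rw [ht, div_le_one hk1]; linarith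
  have h3 : Ring.choose (α - 1) (k + 1) = -t * Ring.choose (α - 1) k := by
    rw [ht]; field_simp; linarith
  rw [h1, h3, abs_mul, abs_neg, abs_of_nonneg ht0,
    show Ring.choose (α - 1) k + -t * Ring.choose (α - 1) k = (1 - t) * Ring.choose (α - 1) k by ring,
    abs_mul, abs_of_nonneg (by linarith)]
  ring

theorem summable_abs_choose (α : ℝ) (hα : 0 < α) : Summable fun k : ℕ => |Ring.choose α k| := by
  obtain ⟨K, hK⟩ := exists_nat_ge α
  rw [← summable_nat_add_iff (K + 1)]
  have key : ∀ N : ℕ, ∑ i ∈ Finset.range N, |Ring.choose α (i + (K + 1))|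
      = |Ring.choose (α - 1) K| - |Ring.choose (α - 1) (N + K)| := by
    intro N
    induction N with
    | zero => simp
    | succ N ih =>
      rw [Finset.sum_range_succ, ih, ← add_assoc, abs_choose_succ_eq α hα (N + K)
        (by push_cast; linarith [(Nat.cast_nonneg N : (0 : ℝ) ≤ N)]),
        show N + 1 + K = N + K + 1 by ring]
      ring
  refine summable_of_sum_range_le (c := |Ring.choose (α - 1) K|) (fun _ => abs_nonneg _) fun N => ?_
  rw [key]
  linarith [abs_nonneg (Ring.choose (α - 1) (N + K))]

theorem summable_abs_glWeight (α : ℝ) (hα : 0 < α) : Summable fun k : ℕ => |glWeight α k| := by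
  simpa [glWeight, abs_mul] using summable_abs_choose α hα

/-! ### Generating functions on the closed unit disc. -/

theorem hasSum_of_forall_eq {f g : ℕ → ℂ} {a : ℂ} (hf : HasSum f a) (h : ∀ k, g k = f k) :
    HasSum g a :=
  (funext h : g = f) ▸ hf

theorem summable_norm_mul_pow {w : ℕ → ℝ} (hw : Summable fun k => |w k|) {z : ℂ} (hz : ‖z‖ ≤ 1) :
    Summable fun k => ‖(w k : ℂ) * z ^ k‖ := by
  refine hw.of_nonneg_of_le (fun _ => norm_nonneg _) fun k => ?_
  rw [norm_mul, norm_pow, Complex.norm_real, Real.norm_eq_abs]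
  exact mul_le_of_le_one_right (abs_nonneg _) (pow_le_one₀ (norm_nonneg _) hz)

theorem hasSum_glWeight_of_norm_lt_one (α : ℝ) {z : ℂ} (hz : ‖z‖ < 1) :
    HasSum (fun k => (glWeight α k : ℂ) * z ^ k) ((1 - z) ^ (α : ℂ)) := by
  have h := (Complex.one_add_cpow_hasFPowerSeriesOnBall_zero (a := (α : ℂ))).hasSum
    (y := -z) (by simpa [enorm_eq_nnnorm, ← NNReal.coe_lt_coe] using hz)
  simp only [zero_add, binomialSeries_apply, List.ofFn_const, List.prod_replicate,
    smul_eq_mul] at h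
  rw [← sub_eq_add_neg] at h
  refine hasSum_of_forall_eq h fun k => ?_
  rw [glWeight, neg_pow z k]
  push_cast
  ring

/-- Abel's theorem carries the binomial series to the unit circle. The power `w ^ α` is continuous
at `w = 1 - z`, because `Re w ≥ 0` avoids the branch cut and `α > 0` covers `w = 0`. -/
theorem hasSum_glWeight (α : ℝ) (hα : 0 < α) {z : ℂ} (hz : ‖z‖ ≤ 1) :
    HasSum (fun k => (glWeight α k : ℂ) * z ^ k) ((1 - z) ^ (α : ℂ)) := by
  have hs := (summable_norm_mul_pow (summable_abs_glWeight α hα) hz).of_norm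
  have h1 := Complex.tendsto_tsum_powerSeries_nhdsWithin_lt hs.hasSum.tendsto_sum_nat
  have hcont : ContinuousAt (fun w : ℂ => w ^ (α : ℂ)) (1 - z) := by
    have := Complex.continuousAt_cpow_of_re_pos (p := (1 - z, (α : ℂ)))
      (Or.inl (by simpa using (Complex.re_le_norm z).trans hz)) (by simpa using hα)
    exact this.comp (f := fun w : ℂ => (w, (α : ℂ))) (by fun_prop)
  have h2 : Tendsto (fun t : ℝ => (1 - (t : ℂ) * z) ^ (α : ℂ)) (𝓝[<] 1) (𝓝 ((1 - z) ^ (α : ℂ))) := by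
    refine hcont.tendsto.comp (tendsto_nhdsWithin_of_tendsto_nhds ?_)
    have : Continuous fun t : ℝ => 1 - (t : ℂ) * z := by fun_prop
    simpa using this.tendsto 1
  have h3 : Tendsto (fun t : ℝ => (1 - (t : ℂ) * z) ^ (α : ℂ)) (𝓝[<] 1)
      (𝓝 (∑' k, (glWeight α k : ℂ) * z ^ k)) := by
    refine (tendsto_map'_iff.1 h1).congr' ?_
    have h01 : ∀ᶠ t : ℝ in 𝓝[<] 1, t ∈ Set.Ioo (0 : ℝ) 1 := Ioo_mem_nhdsLT one_pos
    filter_upwards [h01] with t ht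
    have htz : ‖(t : ℂ) * z‖ < 1 := by
      rw [norm_mul, Complex.norm_real, Real.norm_eq_abs, abs_of_pos ht.1]
      nlinarith [norm_nonneg z, ht.1, ht.2]
    rw [← (hasSum_glWeight_of_norm_lt_one α htz).tsum_eq]
    simp only [Function.comp_apply, mul_pow]
    exact tsum_congr fun k => by ring
  exact tendsto_nhds_unique h3 h2 ▸ hs.hasSum

theorem exists_hasSum_linear_cpow (α c : ℝ) (n : ℕ) (hα : 0 < α) (hc : 1 / 2 ≤ c ∨ α = n) :
    ∃ b : ℕ → ℝ, (Summable fun k => |b k|) ∧ ∀ z : ℂ, ‖z‖ ≤ 1 →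
      HasSum (fun k => (b k : ℂ) * z ^ k) ((c + (1 - c) * z) ^ (α : ℂ)) := by
  rcases hc with hc | rfl
  · have hc0 : 0 < c := by linarith
    -- `c + (1 - c) z = c (1 - q z)`, and `c ≥ 1/2` is exactly what gives `|q| ≤ 1`.
    set q : ℝ := (c - 1) / c with hq
    have hq1 : |q| ≤ 1 := by
      rw [hq, abs_le, le_div_iff₀ hc0, div_le_iff₀ hc0]; constructor <;> linarith
    refine ⟨fun k => c ^ α * (glWeight α k * q ^ k), ?_, fun z hz => ?_⟩
    · simp only [abs_mul, abs_pow]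
      refine Summable.mul_left _ ((summable_abs_glWeight α hα).of_nonneg_of_le
        (fun _ => by positivity) fun k => ?_)
      exact mul_le_of_le_one_right (abs_nonneg _) (pow_le_one₀ (abs_nonneg _) hq1)
    · have hqz : ‖(q : ℂ) * z‖ ≤ 1 := by
        rw [norm_mul, Complex.norm_real, Real.norm_eq_abs]
        exact mul_le_one₀ hq1 (norm_nonneg _) hz
      have h := (hasSum_glWeight α hα hqz).mul_left ((c ^ α : ℝ) : ℂ)
      have e : ((c ^ α : ℝ) : ℂ) * (1 - (q : ℂ) * z) ^ (α : ℂ) = (c + (1 - c) * z) ^ (α : ℂ) := by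
        have hb : (c : ℂ) + (1 - c) * z = (c : ℂ) * (1 - q * z) := by
          have : (c : ℂ) ≠ 0 := by exact_mod_cast hc0.ne'
          rw [hq]; push_cast; field_simp; ring
        have hα' : (α : ℂ) ≠ 0 := by exact_mod_cast hα.ne'
        rw [hb]
        rcases eq_or_ne (1 - (q : ℂ) * z) 0 with h0 | h0
        · rw [h0, mul_zero, Complex.zero_cpow hα', mul_zero]
        · have hcc : (c : ℂ) ≠ 0 := by exact_mod_cast hc0.ne'
          rw [Complex.cpow_def_of_ne_zero (mul_ne_zero hcc h0), Complex.log_ofReal_mul hc0 h0,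
            add_mul, Complex.exp_add, Complex.cpow_def_of_ne_zero h0, Complex.ofReal_cpow hc0.le,
            Complex.cpow_def_of_ne_zero hcc, Complex.ofReal_log hc0.le]
      rw [e] at h
      refine hasSum_of_forall_eq h fun k => ?_
      push_cast
      ring
  · set P : Polynomial ℝ := (Polynomial.C c + Polynomial.C (1 - c) * Polynomial.X) ^ n with hP
    have hsupp : ∀ k ∉ Finset.range (P.natDegree + 1), P.coeff k = 0 := fun k hk =>
      Polynomial.coeff_eq_zero_of_natDegree_lt (by simpa using hk)
    refine ⟨P.coeff, summable_of_ne_finset_zero (s := Finset.range (P.natDegree + 1))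
      fun k hk => by simp [hsupp k hk], fun z _ => ?_⟩
    have h : HasSum (fun k => (P.coeff k : ℂ) * z ^ k)
        (∑ k ∈ Finset.range (P.natDegree + 1), (P.coeff k : ℂ) * z ^ k) :=
      hasSum_sum_of_ne_finset_zero fun k hk => by simp [hsupp k hk]
    convert h using 1
    have h1 := Polynomial.aeval_eq_sum_range (p := P) z
    have h2 : Polynomial.aeval z P = ((c : ℂ) + (1 - c) * z) ^ n := by simp [hP]
    rw [Complex.ofReal_natCast, Complex.cpow_natCast, ← h2, h1]
    simp [Algebra.smul_def]

/-- The real power splits over the two linear factors near `0`, where both are positive. For `α = n`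
it is an ordinary power and splits everywhere. -/
theorem genW2_eq_cpow_mul (α r : ℝ) (n : ℕ) (hα : 0 < α) (hr : r ≤ α ∨ α = n) :
    ∀ᶠ x : ℝ in 𝓝 0, (genW2 α r x : ℂ) = (1 - x) ^ (α : ℂ) *
      ((3 / 2 - r / α : ℝ) + (1 - (3 / 2 - r / α : ℝ)) * x) ^ (α : ℂ) := by
  have hf : ∀ x : ℝ, (3 / 2 - r / α) + (-2 + 2 * r / α) * x + (1 / 2 - r / α) * x ^ 2
      = (1 - x) * ((3 / 2 - r / α) + (1 - (3 / 2 - r / α)) * x) := fun x => by ring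
  simp only [genW2, hf]
  rcases hr with hr | rfl
  · set c := 3 / 2 - r / α
    have hc : 0 < c := by
      have : r / α ≤ 1 := by rw [div_le_one hα]; exact hr
      simp only [c]; linarith
    have h1 : ∀ᶠ x : ℝ in 𝓝 0, 0 < 1 - x :=
      (by fun_prop : Continuous fun x : ℝ => 1 - x).continuousAt.eventually (lt_mem_nhds (by simp))
    have h2 : ∀ᶠ x : ℝ in 𝓝 0, 0 < c + (1 - c) * x :=
      (by fun_prop : Continuous fun x : ℝ => c + (1 - c) * x).continuousAt.eventually
        (lt_mem_nhds (by simpa))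
    filter_upwards [h1, h2] with x h1 h2
    rw [Real.mul_rpow h1.le h2.le]
    push_cast
    rw [Complex.ofReal_cpow h1.le, Complex.ofReal_cpow h2.le]
    push_cast
    rfl
  · refine Eventually.of_forall fun x => ?_
    simp only [Complex.ofReal_natCast, Complex.cpow_natCast, Real.rpow_natCast]
    push_cast
    rw [mul_pow]

theorem iteratedDeriv_div_factorial_eq {f : ℝ → ℝ} {w : ℕ → ℝ}
    (hf : ∀ᶠ x : ℝ in 𝓝 0, HasSum (fun k => w k * x ^ k) (f x)) (k : ℕ) :
    iteratedDeriv k f 0 / (k.factorial : ℝ) = w k := by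
  have hp : HasFPowerSeriesAt f (FormalMultilinearSeries.ofScalars ℝ w) 0 := by
    rw [hasFPowerSeriesAt_iff]
    simpa [mul_comm, FormalMultilinearSeries.coeff_ofScalars] using hf
  have h := hp.eq_formalMultilinearSeries hp.analyticAt.hasFPowerSeriesAt
  have h2 := congrArg (fun p => FormalMultilinearSeries.coeff p k) h
  simp only [FormalMultilinearSeries.coeff_ofScalars] at h2
  exact h2.symm

theorem exists_w2_spec (α r : ℝ) (n : ℕ) (hα : 0 < α) (hr : r ≤ α ∨ α = n) :
    (Summable fun k => |w2 α r k|) ∧ ∀ z : ℂ, ‖z‖ ≤ 1 →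
      HasSum (fun k => (w2 α r k : ℂ) * z ^ k) ((1 - z) ^ (α : ℂ) *
        ((3 / 2 - r / α : ℝ) + (1 - (3 / 2 - r / α : ℝ)) * z) ^ (α : ℂ)) := by
  obtain ⟨b, hb, hbs⟩ := exists_hasSum_linear_cpow α (3 / 2 - r / α) n hα (hr.imp_left fun h => by
    have : r / α ≤ 1 := by rw [div_le_one hα]; exact h
    linarith)
  -- The Cauchy product of the two coefficient sequences. It is identified with `w2` only
  -- afterwards, by uniqueness of power series.
  set w : ℕ → ℝ := fun m => ∑ k ∈ Finset.range (m + 1), glWeight α k * b (m - k) with hwdef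
  have hg := summable_abs_glWeight α hα
  have hw : Summable fun k => |w k| := by
    simpa using summable_norm_sum_mul_range_of_summable_norm (f := glWeight α) (g := b)
      (by simpa using hg) (by simpa using hb)
  have hws : ∀ z : ℂ, ‖z‖ ≤ 1 → HasSum (fun k => (w k : ℂ) * z ^ k) ((1 - z) ^ (α : ℂ) *
        ((3 / 2 - r / α : ℝ) + (1 - (3 / 2 - r / α : ℝ)) * z) ^ (α : ℂ)) := by
    intro z hz
    have h := hasSum_sum_range_mul_of_summable_norm (summable_norm_mul_pow hg hz)
      (summable_norm_mul_pow hb hz)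
    rw [(hasSum_glWeight α hα hz).tsum_eq, (hbs z hz).tsum_eq] at h
    refine hasSum_of_forall_eq h fun m => ?_
    simp only [hwdef]
    push_cast
    rw [Finset.sum_mul]
    refine Finset.sum_congr rfl fun k hk => ?_
    have : z ^ m = z ^ k * z ^ (m - k) := by
      rw [← pow_add, Nat.add_sub_cancel' (Nat.lt_succ_iff.1 (Finset.mem_range.1 hk))]
    rw [this]; ring
  have heq : w2 α r = w := by
    funext k
    refine iteratedDeriv_div_factorial_eq ?_ k
    have h1 : ∀ᶠ x : ℝ in 𝓝 0, |x| < 1 :=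
      continuous_abs.continuousAt.eventually (gt_mem_nhds (by simp))
    filter_upwards [genW2_eq_cpow_mul α r n hα hr, h1] with x hx hx1
    have := hws x (by simpa using hx1.le)
    rw [← hx] at this
    exact_mod_cast this
  rw [heq]
  exact ⟨hw, hws⟩

/-! ### Expansions at the origin. -/

/-- The function `(1 - e^{-s}) / s`. -/
def expQuot (s : ℂ) : ℂ := (1 - Complex.exp (-s)) / s

theorem isBigO_of_pow_le {i j : ℕ} (h : j ≤ i) :
    (fun s : ℂ => s ^ i) =O[𝓝[≠] 0] fun s => s ^ j := by
  refine IsBigO.of_bound 1 (eventually_nhdsWithin_of_eventually_nhds ?_)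
  filter_upwards [Metric.ball_mem_nhds (0 : ℂ) one_pos] with s hs
  rw [norm_pow, norm_pow, one_mul]
  exact pow_le_pow_of_le_one (norm_nonneg _) (mem_ball_zero_iff.1 hs).le h

theorem expQuot_expansion :
    (fun s => expQuot s - 1 - (-s / 2 + s ^ 2 / 6)) =O[𝓝[≠] 0] fun s : ℂ => s ^ 3 := by
  have ht : Tendsto (fun s : ℂ => -s) (𝓝[≠] 0) (𝓝 0) :=
    tendsto_nhdsWithin_of_tendsto_nhds (by simpa using (continuous_neg (G := ℂ)).tendsto 0)
  have h := (Complex.exp_sub_sum_range_isBigO_pow 4).comp_tendsto ht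
  have h2 := h.mul (isBigO_refl (fun s : ℂ => s⁻¹) (𝓝[≠] 0))
  have h3 : (fun s : ℂ => ((fun x => x ^ 4) ∘ fun s => -s) s * s⁻¹) =O[𝓝[≠] 0]
      fun s : ℂ => s ^ 3 := by
    refine IsBigO.of_bound 1 ?_
    filter_upwards [self_mem_nhdsWithin] with s hs
    have hs : s ≠ 0 := hs
    have : (-s) ^ 4 * s⁻¹ = s ^ 3 := by field_simp
    simp [this]
  refine ((h2.trans h3).neg_left).congr' ?_ EventuallyEq.rfl
  filter_upwards [self_mem_nhdsWithin] with s hs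
  have hs : s ≠ 0 := hs
  simp only [Function.comp_apply, Finset.sum_range_succ, Finset.sum_range_zero, expQuot,
    Nat.factorial]
  push_cast
  field_simp
  ring

theorem log_one_add_expansion :
    (fun w : ℂ => Complex.log (1 + w) - (w - w ^ 2 / 2)) =O[𝓝 0] fun w => w ^ 3 := by
  refine (Complex.log_sub_logTaylor_isBigO 2).congr_left fun w => ?_
  simp [Complex.logTaylor_succ, Complex.logTaylor_zero]
  ring

/-- Logarithm of the ratio between the symbol of the difference operator and its limit. -/
def logSymbol (ρ : ℝ) (s : ℂ) : ℂ :=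
  Complex.log (expQuot s) +
    Complex.log ((3 / 2 - ρ : ℝ) + (1 - (3 / 2 - ρ : ℝ)) * Complex.exp (-s)) + ρ * s

theorem logSymbol_expansion (ρ : ℝ) :
    (fun s => logSymbol ρ s - ((-1 / 3 + ρ - ρ ^ 2 / 2 : ℝ) : ℂ) * s ^ 2)
      =O[𝓝[≠] 0] fun s : ℂ => s ^ 3 := by
  set l := 𝓝[≠] (0 : ℂ) with hl
  set d : ℂ := 1 / 2 - ρ with hd
  set w : ℂ → ℂ := fun s => expQuot s - 1 with hw
  -- With `c = 3/2 - ρ` and `d = c - 1`, `1 + v s` is the factor `c + (1 - c) e^{-s}`, rewritten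
  -- through `1 - e^{-s} = s (1 + w s)`.
  set v : ℂ → ℂ := fun s => d * s * (1 + w s) with hv
  have h1 : (fun s => w s - (-s / 2 + s ^ 2 / 6)) =O[l] fun s : ℂ => s ^ 3 := expQuot_expansion
  have p32 : (fun s : ℂ => s ^ 3) =O[l] fun s => s ^ 2 := isBigO_of_pow_le (by norm_num)
  have p21 : (fun s : ℂ => s ^ 2) =O[l] fun s => s := by
    simpa using isBigO_of_pow_le (i := 2) (j := 1) (by norm_num)
  have p11 : (fun s : ℂ => s) =O[l] fun s => s := isBigO_refl _ _
  have m12 : ∀ {f g : ℂ → ℂ}, f =O[l] (fun s => s) → g =O[l] (fun s => s ^ 2) →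
      (fun s => f s * g s) =O[l] fun s => s ^ 3 := fun hf hg =>
    (hf.mul hg).congr_right fun s => by ring
  have h2 : (fun s => w s + s / 2) =O[l] fun s : ℂ => s ^ 2 :=
    ((h1.trans p32).add ((isBigO_refl (fun s : ℂ => s ^ 2) l).const_mul_left (1 / 6))).congr_left
      fun s => by ring
  have h3 : w =O[l] fun s : ℂ => s :=
    ((h2.trans p21).sub (p11.const_mul_left (1 / 2))).congr_left fun s => by ring
  have h4 : (fun s => w s - s / 2) =O[l] fun s : ℂ => s :=
    (h3.sub (p11.const_mul_left (1 / 2))).congr_left fun s => by ring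
  have h5 : (fun s => w s ^ 2 - s ^ 2 / 4) =O[l] fun s : ℂ => s ^ 3 :=
    (m12 h4 h2).congr_left fun s => by ring
  have tl : Tendsto (fun s : ℂ => s) l (𝓝 0) := tendsto_nhdsWithin_of_tendsto_nhds tendsto_id
  have h6 : (fun s => v s - d * s) =O[l] fun s : ℂ => s ^ 2 :=
    ((p11.mul h3).const_mul_left d).congr (fun s => by simp only [hv]; ring) fun s => by ring
  have h7 : v =O[l] fun s : ℂ => s :=
    ((h6.trans p21).add (p11.const_mul_left d)).congr_left fun s => by ring
  have h8 : (fun s => v s ^ 2 - d ^ 2 * s ^ 2) =O[l] fun s : ℂ => s ^ 3 :=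
    (m12 (h7.add (p11.const_mul_left d)) h6).congr_left fun s => by ring
  have h9 : (fun s => v s - d * (s - s ^ 2 / 2)) =O[l] fun s : ℂ => s ^ 3 :=
    ((m12 p11 h2).const_mul_left d).congr_left fun s => by simp only [hv]; ring
  have hlog : ∀ {f : ℂ → ℂ}, f =O[l] (fun s => s) →
      (fun s => Complex.log (1 + f s) - (f s - f s ^ 2 / 2)) =O[l] fun s => s ^ 3 := fun hf =>
    (log_one_add_expansion.comp_tendsto (hf.trans_tendsto tl)).trans (hf.pow 3)
  have hL := (((hlog h3).add (hlog h7)).add (h1.sub (h5.const_mul_left (1 / 2)))).add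
    (h9.sub (h8.const_mul_left (1 / 2)))
  refine hL.congr' ?_ EventuallyEq.rfl
  filter_upwards [self_mem_nhdsWithin] with s hs
  have hs : s ≠ 0 := hs
  have e1 : 1 + w s = expQuot s := by simp [hw]
  have e2 : 1 + v s = (3 / 2 - ρ : ℝ) + (1 - (3 / 2 - ρ : ℝ)) * Complex.exp (-s) := by
    simp only [hv, e1, expQuot, hd]
    push_cast
    field_simp
    ring
  simp only [logSymbol, e1, ← e2, hd]
  push_cast
  ring

theorem expQuot_tendsto : Tendsto expQuot (𝓝[≠] 0) (𝓝 1) := by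
  have h := expQuot_expansion
  have t3 : Tendsto (fun s : ℂ => s ^ 3) (𝓝[≠] 0) (𝓝 0) :=
    tendsto_nhdsWithin_of_tendsto_nhds (by simpa using (continuous_pow (M := ℂ) 3).tendsto 0)
  have h0 := h.trans_tendsto t3
  have t1 : Tendsto (fun s : ℂ => 1 + (-s / 2 + s ^ 2 / 6)) (𝓝[≠] 0) (𝓝 1) :=
    tendsto_nhdsWithin_of_tendsto_nhds (by
      have : Continuous fun s : ℂ => 1 + (-s / 2 + s ^ 2 / 6) := by fun_prop
      simpa using this.tendsto 0)
  simpa using h0.add t1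

/-! ### Fourier symbols: local expansions and global bounds. -/

theorem tendsto_I_mul : Tendsto (fun y : ℝ => Complex.I * y) (𝓝[≠] 0) (𝓝[≠] 0) := by
  refine tendsto_nhdsWithin_iff.2 ⟨tendsto_nhdsWithin_of_tendsto_nhds ?_, ?_⟩
  · have : Continuous fun y : ℝ => Complex.I * y := by fun_prop
    simpa using this.tendsto 0
  · filter_upwards [self_mem_nhdsWithin] with y hy
    simpa using hy

/-- The Fourier symbol `(iy)^α` of the fractional derivative. -/
def fracSymbol (α y : ℝ) : ℂ := (Complex.I * y) ^ (α : ℂ)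

theorem norm_fracSymbol (α y : ℝ) : ‖fracSymbol α y‖ = |y| ^ α := by
  simp [fracSymbol, Complex.norm_cpow_real]

theorem fracSymbol_zero {α : ℝ} (hα : 0 < α) : fracSymbol α 0 = 0 := by
  have : (α : ℂ) ≠ 0 := by exact_mod_cast hα.ne'
  simp [fracSymbol, Complex.zero_cpow this]

theorem fracSymbol_mul {α h : ℝ} (hα : 0 < α) (hh : 0 < h) (y : ℝ) :
    fracSymbol α (h * y) = (h ^ α : ℝ) * fracSymbol α y := by
  rcases eq_or_ne y 0 with rfl | hy
  · simp [fracSymbol_zero hα]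
  · have h0 : Complex.I * (y : ℂ) ≠ 0 := by simpa using hy
    have hc : (h : ℂ) ≠ 0 := by exact_mod_cast hh.ne'
    rw [fracSymbol, fracSymbol, Complex.ofReal_mul,
      show Complex.I * ((h : ℂ) * y) = h * (Complex.I * y) by ring,
      Complex.cpow_def_of_ne_zero (mul_ne_zero hc h0), Complex.log_ofReal_mul hh h0, add_mul,
      Complex.exp_add, Complex.cpow_def_of_ne_zero h0, Complex.ofReal_cpow hh.le,
      Complex.cpow_def_of_ne_zero hc, Complex.ofReal_log hh.le]

theorem one_sub_exp_cpow_eventually (α : ℝ) :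
    ∀ᶠ y : ℝ in 𝓝[≠] 0, (1 - Complex.exp (-(Complex.I * y))) ^ (α : ℂ) =
      fracSymbol α y * Complex.exp (α * Complex.log (expQuot (Complex.I * y))) := by
  have h := (expQuot_tendsto.comp tendsto_I_mul).eventually
    ((Complex.continuous_re.tendsto 1).eventually (lt_mem_nhds (by simp : (0 : ℝ) < (1 : ℂ).re)))
  filter_upwards [h, self_mem_nhdsWithin] with y hy hy0
  simp only [Function.comp_apply] at hy
  have hs : Complex.I * (y : ℂ) ≠ 0 := by simpa using hy0
  have hq : expQuot (Complex.I * y) ≠ 0 := fun h => by simp [h] at hy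
  have e : 1 - Complex.exp (-(Complex.I * y)) = Complex.I * y * expQuot (Complex.I * y) := by
    rw [expQuot, mul_div_cancel₀ _ hs]
  -- The two arguments sum to something strictly inside `(-π, π)`, so the principal logarithm of the
  -- product is the sum of the logarithms.
  have a1 : |Complex.arg (Complex.I * y)| ≤ Real.pi / 2 :=
    Complex.abs_arg_le_pi_div_two_iff.2 (by simp)
  have a2 : |Complex.arg (expQuot (Complex.I * y))| < Real.pi / 2 :=
    Complex.abs_arg_lt_pi_div_two_iff.2 (Or.inl hy)
  rw [abs_le] at a1
  rw [abs_lt] at a2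
  rw [e, fracSymbol, Complex.cpow_def_of_ne_zero (mul_ne_zero hs hq),
    Complex.log_mul hs hq ⟨by linarith, by linarith⟩, Complex.cpow_def_of_ne_zero hs, add_mul,
    Complex.exp_add, mul_comm (Complex.log (expQuot _))]

theorem exp_expansion_one : (fun v : ℂ => Complex.exp v - 1) =O[𝓝 0] fun v => v := by
  simpa using Complex.exp_sub_sum_range_isBigO_pow 1

theorem exp_expansion_two : (fun v : ℂ => Complex.exp v - (1 + v)) =O[𝓝 0] fun v => v ^ 2 := by
  simpa [Finset.sum_range_succ] using Complex.exp_sub_sum_range_isBigO_pow 2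

/-- The exponent is itself `O(s²)`, so the quadratic remainder of `exp` is `O(s⁴)` and only the
linear term contributes. -/
theorem exp_mul_logSymbol_expansion (α r : ℝ) (hα : 0 < α) :
    (fun s : ℂ => Complex.exp (α * logSymbol (r / α) s) - (1 + a2 α r * s ^ 2))
      =O[𝓝[≠] 0] fun s : ℂ => s ^ 3 := by
  set κ : ℂ := ((-1 / 3 + r / α - (r / α) ^ 2 / 2 : ℝ) : ℂ) with hκ
  have hκa : (α : ℂ) * κ = a2 α r := by
    have : (α : ℂ) ≠ 0 := by exact_mod_cast hα.ne'
    rw [hκ, a2]; push_cast; field_simp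
  have h1 := (logSymbol_expansion (r / α)).const_mul_left (α : ℂ)
  have h2 : (fun s => (α : ℂ) * logSymbol (r / α) s) =O[𝓝[≠] 0] fun s : ℂ => s ^ 2 :=
    ((h1.trans (isBigO_of_pow_le (by norm_num : 2 ≤ 3))).add
      ((isBigO_refl (fun s : ℂ => s ^ 2) (𝓝[≠] 0)).const_mul_left (α * κ))).congr_left
      fun s => by ring
  have t2 : Tendsto (fun s : ℂ => s ^ 2) (𝓝[≠] 0) (𝓝 0) :=
    tendsto_nhdsWithin_of_tendsto_nhds (by simpa using (continuous_pow (M := ℂ) 2).tendsto 0)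
  have h3 := (exp_expansion_two.comp_tendsto (h2.trans_tendsto t2)).trans (h2.pow 2)
  have h4 := (h3.congr_right fun s => (pow_mul s 2 2).symm).trans
    (isBigO_of_pow_le (by norm_num : 3 ≤ 2 * 2))
  refine (h4.add h1).congr_left fun s => ?_
  simp only [Function.comp_apply, ← hκa]
  ring

theorem exp_mul_log_expQuot_expansion (α : ℝ) :
    (fun s : ℂ => Complex.exp (α * Complex.log (expQuot s)) - 1) =O[𝓝[≠] 0] fun s : ℂ => s := by
  have tl : Tendsto (fun s : ℂ => s) (𝓝[≠] 0) (𝓝 0) := tendsto_nhdsWithin_of_tendsto_nhds tendsto_id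
  have p11 : (fun s : ℂ => s) =O[𝓝[≠] 0] fun s => s := isBigO_refl _ _
  have h1 : (fun s => expQuot s - 1) =O[𝓝[≠] 0] fun s : ℂ => s := by
    have p1 : ∀ i : ℕ, 1 ≤ i → (fun s : ℂ => s ^ i) =O[𝓝[≠] 0] fun s => s := fun i hi => by
      simpa using isBigO_of_pow_le (i := i) (j := 1) hi
    exact (((expQuot_expansion.trans (p1 3 (by norm_num))).add (p11.const_mul_left (-1 / 2))).add
      ((p1 2 (by norm_num)).const_mul_left (1 / 6))).congr_left fun s => by ring
  have h2 : (fun s => Complex.log (expQuot s)) =O[𝓝[≠] 0] fun s : ℂ => s := by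
    have hl : (fun w : ℂ => Complex.log (1 + w)) =O[𝓝 0] fun w => w := by
      have := Complex.log_sub_logTaylor_isBigO 0
      simpa [Complex.logTaylor_succ, Complex.logTaylor_zero] using this
    have := (hl.comp_tendsto (h1.trans_tendsto tl)).trans h1
    simpa [Function.comp_def] using this
  have h3 := h2.const_mul_left (α : ℂ)
  exact (exp_expansion_one.comp_tendsto (h3.trans_tendsto tl)).trans h3

/-- A local symbol estimate near `0` of a bounded symbol extends to the whole line. -/
theorem exists_global_bound {α A S : ℝ} {m : ℕ} (hα : 0 < α) {F P : ℝ → ℂ}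
    (hF : ∀ y, ‖F y‖ ≤ S) (hF0 : F 0 = 0) (hP : ∀ y, ‖P y‖ ≤ A * (1 + |y| ^ m))
    (hloc : (fun y => F y - fracSymbol α y * P y) =O[𝓝[≠] 0] fun y : ℝ => |y| ^ α * |y| ^ m) :
    ∃ C, 0 ≤ C ∧ ∀ y, ‖F y - fracSymbol α y * P y‖ ≤ C * (|y| ^ α * |y| ^ m) := by
  obtain ⟨C₁, hC₁, h1⟩ := hloc.exists_pos
  rw [IsBigOWith, eventually_nhdsWithin_iff, Metric.eventually_nhds_iff] at h1
  obtain ⟨δ, hδ, h1⟩ := h1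
  have hS : 0 ≤ S := (norm_nonneg _).trans (hF 0)
  have hA : 0 ≤ A := by
    have := (norm_nonneg _).trans (hP 1)
    norm_num at this
    linarith
  -- For `|y| ≥ δ`, the bounds on `F` and `P` are absorbed using `1 ≤ |y|^α |y|^m / (δ^α δ^m)` and
  -- `1 ≤ |y|^m / δ^m`.
  set C₂ := S / (δ ^ α * δ ^ m) + A * (1 / δ ^ m + 1) with hC₂
  have hC₂0 : 0 ≤ C₂ := by positivity
  refine ⟨max C₁ C₂, le_max_of_le_left hC₁.le, fun y => ?_⟩
  rcases eq_or_ne y 0 with rfl | hy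
  · rw [hF0, fracSymbol_zero hα]
    simp
    positivity
  · rcases lt_or_ge |y| δ with hyδ | hyδ
    · have := h1 (y := y) (by simpa using hyδ) hy
      rw [Real.norm_of_nonneg (by positivity)] at this
      exact this.trans (by gcongr; exact le_max_left _ _)
    · have hy0 : 0 < |y| := abs_pos.2 hy
      have k1 : S ≤ S / (δ ^ α * δ ^ m) * (|y| ^ α * |y| ^ m) := by
        rw [div_mul_eq_mul_div, le_div_iff₀ (by positivity)]
        gcongr
      have k2 : (1 : ℝ) ≤ 1 / δ ^ m * |y| ^ m := by
        rw [div_mul_eq_mul_div, one_mul, le_div_iff₀ (by positivity), one_mul]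
        gcongr
      calc ‖F y - fracSymbol α y * P y‖ ≤ ‖F y‖ + ‖fracSymbol α y‖ * ‖P y‖ := by
            rw [← norm_mul]; exact norm_sub_le _ _
        _ ≤ S / (δ ^ α * δ ^ m) * (|y| ^ α * |y| ^ m) +
            |y| ^ α * (A * (1 / δ ^ m * |y| ^ m + |y| ^ m)) := by
            rw [norm_fracSymbol]
            gcongr
            · exact (hF y).trans k1
            · exact (hP y).trans (by gcongr)
        _ = C₂ * (|y| ^ α * |y| ^ m) := by rw [hC₂]; ring
        _ ≤ _ := by gcongr; exact le_max_right _ _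

/-- The Fourier symbol `∑ w_k e^{i (r - k) y}` of the difference operator with weights `w` and
shift `r`. -/
def diffSymbol (w : ℕ → ℝ) (r y : ℝ) : ℂ :=
  ∑' k : ℕ, (w k : ℂ) * Complex.exp (Complex.I * (((r - k) * y : ℝ) : ℂ))

theorem norm_diffSymbol_le {w : ℕ → ℝ} (hw : Summable fun k => |w k|) (r y : ℝ) :
    ‖diffSymbol w r y‖ ≤ ∑' k, |w k| := by
  refine tsum_of_norm_bounded hw.hasSum fun k => ?_
  rw [norm_mul, Complex.norm_exp_I_mul_ofReal, mul_one, Complex.norm_real, Real.norm_eq_abs]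

theorem diffSymbol_eq {w : ℕ → ℝ} {W : ℂ → ℂ}
    (hW : ∀ z : ℂ, ‖z‖ ≤ 1 → HasSum (fun k => (w k : ℂ) * z ^ k) (W z)) (r y : ℝ) :
    diffSymbol w r y = W (Complex.exp (-(Complex.I * y))) * Complex.exp (r * (Complex.I * y)) := by
  have hz : ‖Complex.exp (-(Complex.I * y))‖ ≤ 1 := by
    rw [Complex.norm_exp]; simp
  rw [diffSymbol, ← ((hW _ hz).mul_right _).tsum_eq]
  refine tsum_congr fun k => ?_
  rw [mul_assoc, ← Complex.exp_nat_mul, ← Complex.exp_add]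
  congr 2
  push_cast
  ring

theorem isBigO_fracSymbol_mul {α : ℝ} {m : ℕ} {g : ℂ → ℂ} (hg : g =O[𝓝[≠] 0] fun s : ℂ => s ^ m) :
    (fun y : ℝ => fracSymbol α y * g (Complex.I * y)) =O[𝓝[≠] 0]
      fun y : ℝ => |y| ^ α * |y| ^ m := by
  refine IsBigO.mul ?_ ?_
  · refine IsBigO.of_bound 1 (Eventually.of_forall fun y => ?_)
    rw [norm_fracSymbol, one_mul, Real.norm_of_nonneg (by positivity)]
  · refine (hg.comp_tendsto tendsto_I_mul).trans (IsBigO.of_bound 1 (Eventually.of_forall fun y => ?_))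
    simp

theorem glSymbol_bound (α : ℝ) (hα : 0 < α) : ∃ C, 0 ≤ C ∧ ∀ y,
    ‖diffSymbol (glWeight α) 0 y - fracSymbol α y‖ ≤ C * (|y| ^ α * |y| ^ 1) := by
  have hD := diffSymbol_eq (fun z hz => hasSum_glWeight α hα hz) 0
  have hα' : (α : ℂ) ≠ 0 := by exact_mod_cast hα.ne'
  have h := exists_global_bound (m := 1) (A := 1) hα (P := fun _ => 1)
    (norm_diffSymbol_le (summable_abs_glWeight α hα) 0)
    (by rw [hD]; simp [Complex.zero_cpow hα']) (by simp) ?_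
  · simpa using h
  · refine (isBigO_fracSymbol_mul (α := α) (m := 1)
      (by simpa using exp_mul_log_expQuot_expansion α)).congr' ?_ EventuallyEq.rfl
    filter_upwards [one_sub_exp_cpow_eventually α] with y hy
    rw [hD, hy]
    simp
    ring

theorem w2Symbol_bound (α r : ℝ) (n : ℕ) (hα : 0 < α) (hr : r ≤ α ∨ α = n) : ∃ C, 0 ≤ C ∧ ∀ y,
    ‖diffSymbol (w2 α r) r y - fracSymbol α y * (1 + a2 α r * (Complex.I * y) ^ 2)‖
      ≤ C * (|y| ^ α * |y| ^ 3) := by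
  obtain ⟨hw, hW⟩ := exists_w2_spec α r n hα hr
  have hD := diffSymbol_eq hW r
  have hα' : (α : ℂ) ≠ 0 := by exact_mod_cast hα.ne'
  refine exists_global_bound (m := 3) (A := 1 + |a2 α r|) hα
    (norm_diffSymbol_le hw r) (by rw [hD]; simp [Complex.zero_cpow hα']) (fun y => ?_) ?_
  · have h1 : |y| ^ 2 ≤ 1 + |y| ^ 3 := by
      rcases le_total |y| 1 with h | h
      · nlinarith [abs_nonneg y, pow_nonneg (abs_nonneg y) 3]
      · nlinarith [abs_nonneg y, pow_nonneg (abs_nonneg y) 2]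
    have h2 : (1 : ℝ) ≤ 1 + |y| ^ 3 := by linarith [pow_nonneg (abs_nonneg y) 3]
    calc ‖(1 : ℂ) + a2 α r * (Complex.I * y) ^ 2‖ ≤ 1 + |a2 α r| * |y| ^ 2 := by
          refine (norm_add_le _ _).trans ?_
          simp
      _ ≤ (1 + |y| ^ 3) + |a2 α r| * (1 + |y| ^ 3) := by gcongr
      _ = _ := by ring
  · refine (isBigO_fracSymbol_mul (α := α) (m := 3)
      (exp_mul_logSymbol_expansion α r hα)).congr' ?_ EventuallyEq.rfl
    -- The base equals `1` at `y = 0`, hence is nonzero nearby. Its power may then be written as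
    -- `exp (α log ·)`.
    have hne : ∀ᶠ y : ℝ in 𝓝[≠] 0, ((3 / 2 - r / α : ℝ) : ℂ) +
        (1 - (3 / 2 - r / α : ℝ)) * Complex.exp (-(Complex.I * y)) ≠ 0 := by
      refine eventually_nhdsWithin_of_eventually_nhds ?_
      have hc : Continuous fun y : ℝ => ((3 / 2 - r / α : ℝ) : ℂ) +
        (1 - (3 / 2 - r / α : ℝ)) * Complex.exp (-(Complex.I * y)) := by fun_prop
      exact hc.continuousAt.eventually_ne (by simp)
    filter_upwards [one_sub_exp_cpow_eventually α, hne] with y hy hne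
    have hαr : (r : ℂ) = α * (r / α : ℝ) := by push_cast; field_simp
    rw [hD, hy, Complex.cpow_def_of_ne_zero hne, logSymbol, mul_add, mul_add, Complex.exp_add,
      Complex.exp_add]
    have e : (α : ℂ) * ((r / α : ℝ) * (Complex.I * y)) = r * (Complex.I * y) := by
      rw [hαr]; ring
    rw [e, mul_comm (Complex.log _) (α : ℂ)]
    ring

/-! ### Decay of the Fourier transform and Fourier inversion. -/

open MeasureTheory FourierTransform

theorem iteratedDeriv_ofReal_comp {u : ℝ → ℝ} {N : ℕ} (hu : ContDiff ℝ ((N : ℕ) : ℕ∞) u) {k : ℕ}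
    (hk : k ≤ N) :
    iteratedDeriv k (fun x => (u x : ℂ)) = fun x => ((iteratedDeriv k u x : ℝ) : ℂ) := by
  induction k with
  | zero => simp
  | succ k ih =>
    rw [iteratedDeriv_succ, ih (by omega)]
    funext x
    rw [iteratedDeriv_succ]
    have hd : DifferentiableAt ℝ (iteratedDeriv k u) x :=
      hu.differentiable_iteratedDeriv k (by exact_mod_cast hk) x
    exact hd.hasDerivAt.ofReal_comp.deriv

theorem contDiff_ofReal_comp {u : ℝ → ℝ} {N : WithTop ℕ∞} (hu : ContDiff ℝ N u) :
    ContDiff ℝ N fun x => (u x : ℂ) :=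
  Complex.ofRealCLM.contDiff.comp hu

/-- The Fourier transform of a real function. -/
def fhat (u : ℝ → ℝ) : ℝ → ℂ := 𝓕 (fun x => (u x : ℂ))

theorem fhat_iteratedDeriv {u : ℝ → ℝ} {N : ℕ} (hu : ContDiff ℝ ((N : ℕ) : ℕ∞) u)
    (hint : ∀ k ≤ N, Integrable (iteratedDeriv k u)) {k : ℕ} (hk : k ≤ N) (ξ : ℝ) :
    fhat (iteratedDeriv k u) ξ = (Complex.I * ((2 * Real.pi * ξ : ℝ) : ℂ)) ^ k * fhat u ξ := by
  have h := Real.fourier_iteratedDeriv (contDiff_ofReal_comp hu) (fun m hm => by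
    have hm' : m ≤ N := by exact_mod_cast hm
    rw [iteratedDeriv_ofReal_comp hu hm']
    exact (hint m hm').ofReal) (n := k) (by exact_mod_cast hk)
  rw [iteratedDeriv_ofReal_comp hu hk] at h
  simp only [fhat, h, smul_eq_mul]
  push_cast
  ring

theorem norm_fhat_le (u : ℝ → ℝ) (ξ : ℝ) : ‖fhat u ξ‖ ≤ ∫ x, |u x| := by
  have := VectorFourier.norm_fourierIntegral_le_integral_norm Real.fourierChar volume
    (innerₗ ℝ) (fun x => (u x : ℂ)) ξ
  simpa [fhat, Real.fourier_eq, VectorFourier.fourierIntegral] using this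

theorem continuous_fhat {u : ℝ → ℝ} (hu : Integrable u) : Continuous (fhat u) := by
  have h : ContDiff ℝ ((0 : ℕ∞) : WithTop ℕ∞) (𝓕 (fun x => (u x : ℂ))) :=
    Real.contDiff_fourier fun n hn => by
      have : n = 0 := by simpa using hn
      subst this
      simpa using hu.norm
  exact h.continuous

theorem continuous_diffSymbol {w : ℕ → ℝ} (hw : Summable fun k => |w k|) (r : ℝ) :
    Continuous (diffSymbol w r) := by
  refine continuous_tsum (fun k => by fun_prop) hw fun k y => ?_
  rw [norm_mul, Complex.norm_exp_I_mul_ofReal, mul_one, Complex.norm_real, Real.norm_eq_abs]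

section Regular

variable {u : ℝ → ℝ} {N : ℕ}

theorem fhat_decay (hu : ContDiff ℝ ((N : ℕ) : ℕ∞) u)
    (hint : ∀ k ≤ N, Integrable (iteratedDeriv k u)) :
    ∃ K, 0 ≤ K ∧ ∀ ξ, ‖fhat u ξ‖ * (1 + |ξ|) ^ N ≤ K := by
  set A := ∫ x, |u x|
  set B := ∫ x, |iteratedDeriv N u x|
  have hA : 0 ≤ A := integral_nonneg fun _ => abs_nonneg _
  have hB : 0 ≤ B := integral_nonneg fun _ => abs_nonneg _
  -- The factor `2 ^ (N - 1)` is the convexity constant in `(1 + |ξ|)^N ≤ 2^(N-1) (1 + |ξ|^N)`.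
  refine ⟨2 ^ (N - 1) * (A + B), by positivity, fun ξ => ?_⟩
  have h1 := norm_fhat_le u ξ
  have h2 := norm_fhat_le (iteratedDeriv N u) ξ
  rw [fhat_iteratedDeriv hu hint le_rfl, norm_mul, norm_pow, norm_mul, Complex.norm_I, one_mul,
    Complex.norm_real, Real.norm_eq_abs, abs_mul, abs_of_pos Real.two_pi_pos] at h2
  have h3 : |ξ| ^ N ≤ (2 * Real.pi * |ξ|) ^ N := by
    gcongr
    nlinarith [Real.pi_gt_three, abs_nonneg ξ]
  calc ‖fhat u ξ‖ * (1 + |ξ|) ^ N ≤ ‖fhat u ξ‖ * (2 ^ (N - 1) * (1 ^ N + |ξ| ^ N)) := by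
        gcongr
        exact add_pow_le zero_le_one (abs_nonneg _) _
    _ = 2 ^ (N - 1) * (‖fhat u ξ‖ + |ξ| ^ N * ‖fhat u ξ‖) := by ring
    _ ≤ 2 ^ (N - 1) * (A + (2 * Real.pi * |ξ|) ^ N * ‖fhat u ξ‖) := by gcongr
    _ ≤ _ := by gcongr

theorem integrable_mul_fhat (hu : ContDiff ℝ ((N : ℕ) : ℕ∞) u)
    (hint : ∀ k ≤ N, Integrable (iteratedDeriv k u)) {g : ℝ → ℂ} {β C : ℝ}
    (hg : AEStronglyMeasurable g volume) (hβN : β + 1 < N)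
    (hgb : ∀ ξ, ‖g ξ‖ ≤ C * (1 + |ξ|) ^ β) : Integrable fun ξ => g ξ * fhat u ξ := by
  obtain ⟨K, hK, hdec⟩ := fhat_decay hu hint
  have hui : Integrable u := by simpa using hint 0 (Nat.zero_le _)
  have hi : Integrable fun ξ : ℝ => C * K * (1 + ‖ξ‖) ^ (-(N - β)) :=
    (integrable_one_add_norm (by simp; linarith)).const_mul _
  refine hi.mono' (hg.mul (continuous_fhat hui).aestronglyMeasurable)
    (Eventually.of_forall fun ξ => ?_)
  have h0 : 0 < 1 + |ξ| := by positivity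
  have h1 : ‖fhat u ξ‖ ≤ K * (1 + |ξ|) ^ (-(N : ℝ)) := by
    rw [Real.rpow_neg h0.le, Real.rpow_natCast, ← div_eq_mul_inv, le_div_iff₀ (by positivity)]
    exact hdec ξ
  calc ‖g ξ * fhat u ξ‖ = ‖g ξ‖ * ‖fhat u ξ‖ := norm_mul _ _
    _ ≤ (C * (1 + |ξ|) ^ β) * (K * (1 + |ξ|) ^ (-(N : ℝ))) :=
        mul_le_mul (hgb ξ) h1 (norm_nonneg _) ((norm_nonneg _).trans (hgb ξ))
    _ = C * K * ((1 + |ξ|) ^ β * (1 + |ξ|) ^ (-(N : ℝ))) := by ring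
    _ = C * K * (1 + ‖ξ‖) ^ (-(N - β)) := by
        rw [← Real.rpow_add h0, Real.norm_eq_abs]; ring_nf

/-- The character `e^{2πi x ξ}`. -/
def echar (x ξ : ℝ) : ℂ := Complex.exp (Complex.I * ((2 * Real.pi * x * ξ : ℝ) : ℂ))

theorem norm_echar (x ξ : ℝ) : ‖echar x ξ‖ = 1 := Complex.norm_exp_I_mul_ofReal _

theorem continuous_echar (x : ℝ) : Continuous (echar x) := by unfold echar; fun_prop

theorem integrable_echar_mul {f : ℝ → ℂ} (hf : Integrable f) (x : ℝ) :
    Integrable fun ξ => echar x ξ * f ξ :=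
  hf.bdd_mul (c := 1) (continuous_echar x).aestronglyMeasurable
    (Eventually.of_forall fun ξ => (norm_echar x ξ).le)

theorem fourierInv_eq_integral_echar (f : ℝ → ℂ) (x : ℝ) : 𝓕⁻ f x = ∫ ξ, echar x ξ * f ξ := by
  rw [Real.fourierInv_eq']
  refine integral_congr_ae (Eventually.of_forall fun ξ => ?_)
  simp only [echar, smul_eq_mul, RCLike.inner_apply, conj_trivial]
  rw [mul_comm Complex.I]
  ring_nf

theorem integrable_fhat (hu : ContDiff ℝ ((N : ℕ) : ℕ∞) u)
    (hint : ∀ k ≤ N, Integrable (iteratedDeriv k u)) (hN : 1 < N) : Integrable (fhat u) := by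
  have := integrable_mul_fhat hu hint (g := fun _ => 1) (β := 0) (C := 1)
    aestronglyMeasurable_const (by simpa using hN) (by simp)
  simpa using this

theorem eq_integral_fhat (hu : ContDiff ℝ ((N : ℕ) : ℕ∞) u)
    (hint : ∀ k ≤ N, Integrable (iteratedDeriv k u)) (hN : 1 < N) (x : ℝ) :
    (u x : ℂ) = ∫ ξ, echar x ξ * fhat u ξ := by
  have hui : Integrable u := by simpa using hint 0 (Nat.zero_le _)
  rw [← fourierInv_eq_integral_echar]
  have h := (contDiff_ofReal_comp hu).continuous.fourierInv_fourier_eq hui.ofReal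
    (integrable_fhat hu hint hN)
  exact (congrFun h x).symm

/-- Each translate of `u` is an inverse Fourier integral. Summability of the weights allows the sum
and the integral to be exchanged, which exhibits `diffSymbol` as the multiplier. -/
theorem hasSum_diff_eq_integral (hu : ContDiff ℝ ((N : ℕ) : ℕ∞) u)
    (hint : ∀ k ≤ N, Integrable (iteratedDeriv k u)) (hN : 1 < N) {w : ℕ → ℝ}
    (hw : Summable fun k => |w k|) (r h x : ℝ) :
    HasSum (fun k : ℕ => ((w k * u (x - ((k : ℝ) - r) * h) : ℝ) : ℂ))
      (∫ ξ, echar x ξ * (diffSymbol w r (h * (2 * Real.pi * ξ)) * fhat u ξ)) := by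
  have hi := integrable_fhat hu hint hN
  have hFi : ∀ k : ℕ, Integrable fun ξ => (w k : ℂ) * (echar (x - ((k : ℝ) - r) * h) ξ * fhat u ξ) :=
    fun k => (integrable_echar_mul hi _).const_mul _
  have hs := hasSum_integral_of_summable_integral_norm hFi (by
    simp only [norm_mul, norm_echar, one_mul, integral_const_mul, Complex.norm_real,
      Real.norm_eq_abs]
    exact hw.mul_right _)
  have e1 : (fun k : ℕ => ((w k * u (x - ((k : ℝ) - r) * h) : ℝ) : ℂ)) = fun k : ℕ =>
      ∫ ξ, (w k : ℂ) * (echar (x - ((k : ℝ) - r) * h) ξ * fhat u ξ) := by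
    funext k
    rw [integral_const_mul, ← eq_integral_fhat hu hint hN]
    push_cast
    rfl
  have e2 : ∫ ξ, echar x ξ * (diffSymbol w r (h * (2 * Real.pi * ξ)) * fhat u ξ) =
      ∫ ξ, ∑' k : ℕ, (w k : ℂ) * (echar (x - ((k : ℝ) - r) * h) ξ * fhat u ξ) := by
    refine integral_congr_ae (Eventually.of_forall fun ξ => ?_)
    simp only [diffSymbol]
    rw [← tsum_mul_right, ← tsum_mul_left]
    refine tsum_congr fun k => ?_
    have : echar (x - ((k : ℝ) - r) * h) ξ = echar x ξ *
        Complex.exp (Complex.I * (((r - k) * (h * (2 * Real.pi * ξ)) : ℝ) : ℂ)) := by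
      rw [echar, echar, ← Complex.exp_add]
      congr 1
      push_cast
      ring
    rw [this]
    ring
  rw [e1, e2]
  exact hs

theorem aestronglyMeasurable_fracSymbol (α : ℝ) :
    AEStronglyMeasurable (fun ξ : ℝ => fracSymbol α (2 * Real.pi * ξ)) volume := by
  have : Measurable fun ξ : ℝ => fracSymbol α (2 * Real.pi * ξ) := by
    unfold fracSymbol; fun_prop
  exact this.aestronglyMeasurable

theorem integrable_fracSymbol_mul_fhat (hu : ContDiff ℝ ((N : ℕ) : ℕ∞) u)
    (hint : ∀ k ≤ N, Integrable (iteratedDeriv k u)) {α : ℝ} (hα : 0 < α) (m : ℕ)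
    (hαN : α + m + 1 < N) :
    Integrable fun ξ => fracSymbol α (2 * Real.pi * ξ) * (ξ : ℂ) ^ m * fhat u ξ := by
  refine integrable_mul_fhat hu hint (β := α + m) (C := (2 * Real.pi) ^ α)
    ((aestronglyMeasurable_fracSymbol α).mul (by fun_prop)) hαN fun ξ => ?_
  have h0 : 0 < 1 + |ξ| := by positivity
  rw [norm_mul, norm_fracSymbol, abs_mul, abs_of_pos Real.two_pi_pos, norm_pow, Complex.norm_real,
    Real.norm_eq_abs, Real.mul_rpow Real.two_pi_pos.le (abs_nonneg _), Real.rpow_add h0,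
    Real.rpow_natCast, mul_assoc]
  gcongr <;> linarith

/-! ### The fractional derivative as a Fourier multiplier. -/

/-- The fractional derivative defined through its Fourier symbol. -/
def fourierFracDeriv (α : ℝ) (u : ℝ → ℝ) : ℝ → ℂ :=
  𝓕⁻ fun ξ => fracSymbol α (2 * Real.pi * ξ) * fhat u ξ

theorem fourierFracDeriv_regularity (hu : ContDiff ℝ ((N : ℕ) : ℕ∞) u)
    (hint : ∀ k ≤ N, Integrable (iteratedDeriv k u)) {α : ℝ} (hα : 0 < α) (hαN : α + 3 < N) :
    ContDiff ℝ 2 (fourierFracDeriv α u) ∧ ∀ x, iteratedDeriv 2 (fourierFracDeriv α u) x =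
      ∫ ξ, echar x ξ * ((Complex.I * ((2 * Real.pi * ξ : ℝ) : ℂ)) ^ 2 *
        (fracSymbol α (2 * Real.pi * ξ) * fhat u ξ)) := by
  set f : ℝ → ℂ := fun ξ => fracSymbol α (2 * Real.pi * ξ) * fhat u ξ with hf
  have hi : ∀ m : ℕ, m ≤ 2 → Integrable fun ξ : ℝ => ξ ^ m • f ξ := fun m hm => by
    have hm' : (m : ℝ) ≤ 2 := by exact_mod_cast hm
    have := integrable_fracSymbol_mul_fhat hu hint hα m (by linarith)
    refine this.congr (Eventually.of_forall fun ξ => ?_)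
    simp only [hf, Complex.real_smul, Complex.ofReal_pow]
    ring
  have hfneg : fourierFracDeriv α u = fun x => 𝓕 f (-x) := by
    funext x; exact Real.fourierInv_eq_fourier_neg _ _
  have hcd : ContDiff ℝ ((2 : ℕ∞) : WithTop ℕ∞) (𝓕 f) := Real.contDiff_fourier fun m hm => by
    have := (hi m (by exact_mod_cast hm)).norm
    simpa [norm_smul] using this
  refine ⟨?_, fun x => ?_⟩
  · rw [hfneg]
    exact hcd.comp contDiff_neg
  · rw [hfneg, iteratedDeriv_comp_neg, Real.iteratedDeriv_fourier (N := 2)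
      (fun m hm => hi m (by exact_mod_cast hm)) (by norm_num),
      ← Real.fourierInv_eq_fourier_neg, fourierInv_eq_integral_echar]
    rw [neg_one_sq, one_smul]
    refine integral_congr_ae (Eventually.of_forall fun ξ => ?_)
    simp only [smul_eq_mul]
    push_cast
    ring

/-- Homogeneity of `fracSymbol` turns a symbol bound of order `|y|^(α+m)` at `h y` into `h^m
|y|^(α+m)` after division by `h^α`. Used with `a = 0`, `m = 1` for the Grünwald quotient and with `a
= a₂(r)`, `m = 3` for the second order operator. -/
theorem norm_diff_sub_le (hu : ContDiff ℝ ((N : ℕ) : ℕ∞) u)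
    (hint : ∀ k ≤ N, Integrable (iteratedDeriv k u)) {α : ℝ} (hα : 0 < α) (hαN : α + 3 < N)
    {w : ℕ → ℝ} (hw : Summable fun k => |w k|) {r a C : ℝ} {m : ℕ} (hm : α + m + 1 < N)
    (hC : ∀ y, ‖diffSymbol w r y - fracSymbol α y * (1 + a * (Complex.I * y) ^ 2)‖
      ≤ C * (|y| ^ α * |y| ^ m)) :
    ∃ K, ∀ h : ℝ, 0 < h → ∀ x : ℝ,
      ‖((1 / h ^ α * ∑' k : ℕ, w k * u (x - ((k : ℝ) - r) * h) : ℝ) : ℂ) -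
        (fourierFracDeriv α u x + a * h ^ 2 * iteratedDeriv 2 (fourierFracDeriv α u) x)‖
        ≤ K * h ^ m := by
  set g : ℝ → ℝ := fun ξ =>
    C * (|2 * Real.pi * ξ| ^ α * |2 * Real.pi * ξ| ^ m * ‖fhat u ξ‖) with hg
  have hgi : Integrable g := by
    have := ((integrable_fracSymbol_mul_fhat hu hint hα m hm).norm.const_mul
      ((2 * Real.pi) ^ m)).const_mul C
    refine this.congr (Eventually.of_forall fun ξ => ?_)
    simp only [hg, norm_mul, norm_fracSymbol, norm_pow, Complex.norm_real, Real.norm_eq_abs,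
      abs_mul, abs_of_pos Real.two_pi_pos]
    simp only [mul_pow]
    ring
  have hN : 1 < N := by
    have : (1 : ℝ) < N := by linarith
    exact_mod_cast this
  have hf0 := integrable_fracSymbol_mul_fhat hu hint hα 0 (by push_cast; linarith)
  have hf2 := integrable_fracSymbol_mul_fhat hu hint hα 2 (by push_cast; linarith)
  refine ⟨∫ ξ, g ξ, fun h hh x => ?_⟩
  have hhα : 0 < h ^ α := Real.rpow_pos_of_pos hh α
  have hhαc : ((h ^ α : ℝ) : ℂ) ≠ 0 := by exact_mod_cast hhα.ne'
  have hsum := hasSum_diff_eq_integral hu hint hN hw r h x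
  have e1 : ((1 / h ^ α * ∑' k : ℕ, w k * u (x - ((k : ℝ) - r) * h) : ℝ) : ℂ) =
      ∫ ξ, echar x ξ * (((1 / h ^ α : ℝ) : ℂ) * diffSymbol w r (h * (2 * Real.pi * ξ)) *
        fhat u ξ) := by
    rw [Complex.ofReal_mul, Complex.ofReal_tsum, hsum.tsum_eq, ← integral_const_mul]
    refine integral_congr_ae (Eventually.of_forall fun ξ => ?_)
    simp only
    ring
  have i0 : Integrable fun ξ => echar x ξ * (fracSymbol α (2 * Real.pi * ξ) * fhat u ξ) :=
    integrable_echar_mul (hf0.congr (Eventually.of_forall fun ξ => by simp)) x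
  have i2 : Integrable fun ξ => echar x ξ * ((Complex.I * ((2 * Real.pi * ξ : ℝ) : ℂ)) ^ 2 *
        (fracSymbol α (2 * Real.pi * ξ) * fhat u ξ)) := by
    refine integrable_echar_mul ((hf2.const_mul ((Complex.I * (2 * Real.pi)) ^ 2)).congr
      (Eventually.of_forall fun ξ => ?_)) x
    simp only
    push_cast
    ring
  have hptw : ∀ ξ, ‖((1 / h ^ α : ℝ) : ℂ) * diffSymbol w r (h * (2 * Real.pi * ξ)) -
      fracSymbol α (2 * Real.pi * ξ) * (1 + a * h ^ 2 * (Complex.I * (2 * Real.pi * ξ : ℝ)) ^ 2)‖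
      ≤ C * (|2 * Real.pi * ξ| ^ α * |2 * Real.pi * ξ| ^ m) * h ^ m := fun ξ => by
    obtain ⟨y, hy⟩ : ∃ y, y = 2 * Real.pi * ξ := ⟨_, rfl⟩
    rw [← hy]
    have h1 := hC (h * y)
    have h2 : ((1 / h ^ α : ℝ) : ℂ) * diffSymbol w r (h * y) -
        fracSymbol α y * (1 + a * h ^ 2 * (Complex.I * y) ^ 2) = ((1 / h ^ α : ℝ) : ℂ) *
        (diffSymbol w r (h * y) - fracSymbol α (h * y) *
          (1 + a * (Complex.I * ((h * y : ℝ) : ℂ)) ^ 2)) := by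
      rw [fracSymbol_mul hα hh, Complex.ofReal_div, Complex.ofReal_one, Complex.ofReal_mul h y]
      generalize fracSymbol α y = F
      generalize diffSymbol w r (h * y) = G
      field_simp
    rw [h2, norm_mul, Complex.norm_real, Real.norm_of_nonneg (by positivity)]
    refine (mul_le_mul_of_nonneg_left h1 (by positivity)).trans (le_of_eq ?_)
    rw [abs_mul, abs_of_pos hh, Real.mul_rpow hh.le (abs_nonneg _), mul_pow]
    field_simp
  have imain : Integrable fun ξ => echar x ξ * (((1 / h ^ α : ℝ) : ℂ) *
      diffSymbol w r (h * (2 * Real.pi * ξ)) * fhat u ξ) := by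
    refine integrable_echar_mul ((integrable_fhat hu hint hN).bdd_mul
      (c := 1 / h ^ α * ∑' k, |w k|) ?_ (Eventually.of_forall fun ξ => ?_)) x
    · exact (continuous_const.mul ((continuous_diffSymbol hw r).comp
        (by fun_prop))).aestronglyMeasurable
    · rw [norm_mul, Complex.norm_real, Real.norm_of_nonneg (by positivity)]
      gcongr
      exact norm_diffSymbol_le hw _ _
  have hAB : Integrable fun ξ => echar x ξ * (fracSymbol α (2 * Real.pi * ξ) * fhat u ξ) +
      a * h ^ 2 * (echar x ξ * ((Complex.I * ((2 * Real.pi * ξ : ℝ) : ℂ)) ^ 2 *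
        (fracSymbol α (2 * Real.pi * ξ) * fhat u ξ))) := i0.add (i2.const_mul _)
  rw [e1, (fourierFracDeriv_regularity hu hint hα hαN).2 x, fourierFracDeriv,
    fourierInv_eq_integral_echar, ← integral_const_mul, ← integral_add i0 (i2.const_mul _),
    ← integral_sub imain hAB, mul_comm (∫ ξ, g ξ), ← integral_const_mul]
  refine norm_integral_le_of_norm_le (hgi.const_mul _) (Eventually.of_forall fun ξ => ?_)
  have : echar x ξ * (((1 / h ^ α : ℝ) : ℂ) * diffSymbol w r (h * (2 * Real.pi * ξ)) * fhat u ξ) -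
      (echar x ξ * (fracSymbol α (2 * Real.pi * ξ) * fhat u ξ) + a * h ^ 2 *
        (echar x ξ * ((Complex.I * ((2 * Real.pi * ξ : ℝ) : ℂ)) ^ 2 *
        (fracSymbol α (2 * Real.pi * ξ) * fhat u ξ)))) = echar x ξ *
      (((1 / h ^ α : ℝ) : ℂ) * diffSymbol w r (h * (2 * Real.pi * ξ)) -
      fracSymbol α (2 * Real.pi * ξ) * (1 + a * h ^ 2 * (Complex.I * (2 * Real.pi * ξ : ℝ)) ^ 2)) *
      fhat u ξ := by ring
  rw [this, norm_mul, norm_mul, norm_echar, one_mul]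
  refine (mul_le_mul_of_nonneg_right (hptw ξ) (norm_nonneg _)).trans (le_of_eq ?_)
  simp only [hg]
  ring

end Regular

/-! ### Integer order: Taylor expansion and moments of the weights. -/

theorem taylor_bound {u : ℝ → ℝ} {N : ℕ} {M x t : ℝ} (hN : 0 < N)
    (hu : ContDiff ℝ ((N : ℕ) : ℕ∞) u)
    (hM : ∀ y ∈ Set.uIcc x (x + t), |iteratedDeriv N u y| ≤ M) :
    |u (x + t) - ∑ j ∈ Finset.range N, iteratedDeriv j u x * t ^ j / (j.factorial : ℝ)|
      ≤ M * |t| ^ N := by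
  obtain ⟨m, rfl⟩ : ∃ m, N = m + 1 := ⟨N - 1, by omega⟩
  have hM0 : 0 ≤ M := (abs_nonneg _).trans (hM x Set.left_mem_uIcc)
  rcases eq_or_ne t 0 with rfl | ht
  · rw [Finset.sum_range_succ']
    simp
  have hne : x ≠ x + t := fun h => ht (by linarith)
  obtain ⟨y, hy, he⟩ := taylor_mean_remainder_lagrange_iteratedDeriv (n := m) (f := u) hne
    (by exact_mod_cast hu.contDiffOn)
  have hT : taylorWithinEval u m (Set.uIcc x (x + t)) x (x + t) =
      ∑ j ∈ Finset.range (m + 1), iteratedDeriv j u x * t ^ j / (j.factorial : ℝ) := by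
    rw [taylor_within_apply]
    refine Finset.sum_congr rfl fun j hj => ?_
    have hj' : j ≤ m + 1 := (Finset.mem_range.1 hj).le
    rw [iteratedDerivWithin_eq_iteratedDeriv (uniqueDiffOn_uIcc hne)
      ((hu.of_le (by exact_mod_cast hj')).contDiffAt) Set.left_mem_uIcc]
    simp only [smul_eq_mul, add_sub_cancel_left]
    field_simp
  rw [← hT, he, add_sub_cancel_left, abs_div, abs_mul, abs_pow, Nat.abs_cast]
  have hf : (1 : ℝ) ≤ ((m + 1).factorial : ℝ) := by exact_mod_cast (m + 1).factorial_pos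
  refine (div_le_self (by positivity) hf).trans ?_
  gcongr
  exact hM y (Set.uIoo_subset_uIcc_self hy)

theorem exists_bound_of_integrable_deriv {f : ℝ → ℝ} (hf : ContDiff ℝ 1 f)
    (hi : Integrable (deriv f)) : ∃ M, ∀ x, |f x| ≤ M := by
  refine ⟨|f 0| + ∫ x, ‖deriv f x‖, fun x => ?_⟩
  have h1 : ∫ y in (0 : ℝ)..x, deriv f y = f x - f 0 :=
    intervalIntegral.integral_deriv_eq_sub (fun y _ => hf.differentiable one_ne_zero y)
      hi.intervalIntegrable
  have h2 : ‖∫ y in (0 : ℝ)..x, deriv f y‖ ≤ ∫ y, ‖deriv f y‖ :=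
    intervalIntegral.norm_integral_le_integral_norm_uIoc.trans
      (setIntegral_le_integral hi.norm (Eventually.of_forall fun y => norm_nonneg _))
  rw [h1, Real.norm_eq_abs] at h2
  calc |f x| = |f 0 + (f x - f 0)| := by ring_nf
    _ ≤ _ := (abs_add_le _ _).trans (by gcongr)

theorem exists_bound_iteratedDeriv {u : ℝ → ℝ} {N : ℕ} (hu : ContDiff ℝ ((N : ℕ) : ℕ∞) u)
    (hint : ∀ k ≤ N, Integrable (iteratedDeriv k u)) {k : ℕ} (hk : k < N) :
    ∃ M, ∀ x, |iteratedDeriv k u x| ≤ M := by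
  refine exists_bound_of_integrable_deriv ?_ ?_
  · refine contDiff_one_iff_deriv.2 ⟨hu.differentiable_iteratedDeriv k (by exact_mod_cast hk), ?_⟩
    rw [← iteratedDeriv_succ]
    exact hu.continuous_iteratedDeriv (k + 1) (by exact_mod_cast hk)
  · rw [← iteratedDeriv_succ]
    exact hint _ hk

theorem eq_zero_of_isBigO_pow (N : ℕ) (a : ℕ → ℂ)
    (h : (fun y : ℝ => ∑ j ∈ Finset.range N, a j * (y : ℂ) ^ j) =O[𝓝[≠] 0] fun y : ℝ => |y| ^ N) :
    ∀ j < N, a j = 0 := by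
  induction N generalizing a with
  | zero => intro j hj; omega
  | succ N ih =>
    have t1 : Tendsto (fun y : ℝ => |y| ^ (N + 1)) (𝓝[≠] 0) (𝓝 0) :=
      tendsto_nhdsWithin_of_tendsto_nhds (by
        have : Continuous fun y : ℝ => |y| ^ (N + 1) := by fun_prop
        simpa using this.tendsto 0)
    have t2 : Tendsto (fun y : ℝ => ∑ j ∈ Finset.range (N + 1), a j * (y : ℂ) ^ j) (𝓝[≠] 0)
        (𝓝 (a 0)) := tendsto_nhdsWithin_of_tendsto_nhds (by
        have : Continuous fun y : ℝ => ∑ j ∈ Finset.range (N + 1), a j * (y : ℂ) ^ j := by fun_prop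
        simpa [Finset.sum_range_succ'] using this.tendsto 0)
    have h0 : a 0 = 0 := tendsto_nhds_unique t2 (h.trans_tendsto t1)
    -- The constant term vanishes by letting `y → 0`; dividing by `y` lowers the order by one.
    have hN := ih (fun j => a (j + 1)) (by
      have := h.mul (isBigO_refl (fun y : ℝ => ((y : ℂ))⁻¹) (𝓝[≠] 0)).norm_right
      refine this.congr' ?_ ?_
      · filter_upwards [self_mem_nhdsWithin] with y hy
        have hy : (y : ℂ) ≠ 0 := by exact_mod_cast hy
        rw [Finset.sum_range_succ', h0, zero_mul, add_zero, Finset.sum_mul]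
        refine Finset.sum_congr rfl fun j _ => ?_
        rw [pow_succ, ← mul_assoc, mul_inv_cancel_right₀ hy]
      · filter_upwards [self_mem_nhdsWithin] with y hy
        have hy : |y| ≠ 0 := abs_ne_zero.2 hy
        rw [norm_inv, Complex.norm_real, Real.norm_eq_abs,
          pow_succ, mul_inv_cancel_right₀ hy])
    rintro (_ | j) hj
    · exact h0
    · exact hN j (by omega)

theorem w2_natCast_eventually_zero (n : ℕ) (r : ℝ) : ∃ M, ∀ k, M ≤ k → w2 n r k = 0 := by
  set P : Polynomial ℝ := (Polynomial.C (3 / 2 - r / n) + Polynomial.C (-2 + 2 * r / n) *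
    Polynomial.X + Polynomial.C (1 / 2 - r / n) * Polynomial.X ^ 2) ^ n with hP
  have hsupp : ∀ k ∉ Finset.range (P.natDegree + 1), P.coeff k = 0 := fun k hk =>
    Polynomial.coeff_eq_zero_of_natDegree_lt (by simpa using hk)
  refine ⟨P.natDegree + 1, fun k hk => ?_⟩
  have : w2 n r k = P.coeff k := by
    refine iteratedDeriv_div_factorial_eq (Eventually.of_forall fun x => ?_) k
    have h : HasSum (fun k => P.coeff k * x ^ k)
        (∑ k ∈ Finset.range (P.natDegree + 1), P.coeff k * x ^ k) :=
      hasSum_sum_of_ne_finset_zero fun k hk => by simp [hsupp k hk]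
    rw [← Polynomial.eval_eq_sum_range] at h
    have e : genW2 n r x = P.eval x := by
      rw [genW2, Real.rpow_natCast]
      simp [hP]
    rwa [e]
  rw [this]
  exact hsupp k (by simpa using hk)

/-- If the symbol of a finite difference operator agrees with `∑ c_j s^j` to order `N`, its moments
are the `c_j`. -/
theorem moment_eq {w : ℕ → ℝ} {M N : ℕ} {r : ℝ} {c : ℕ → ℝ}
    (h : (fun y : ℝ => ∑ k ∈ Finset.range M, (w k : ℂ) *
        Complex.exp (Complex.I * (((r - k) * y : ℝ) : ℂ)) -
        ∑ j ∈ Finset.range N, (c j : ℂ) * (Complex.I * y) ^ j) =O[𝓝[≠] 0] fun y : ℝ => |y| ^ N)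
    {j : ℕ} (hj : j < N) :
    ∑ k ∈ Finset.range M, w k * (r - k) ^ j / (j.factorial : ℝ) = c j := by
  have hexp : (fun y : ℝ => ∑ k ∈ Finset.range M, (w k : ℂ) *
      (Complex.exp (Complex.I * (((r - k) * y : ℝ) : ℂ)) -
        ∑ j ∈ Finset.range N, (Complex.I * (((r - k) * y : ℝ) : ℂ)) ^ j / (j.factorial : ℂ)))
      =O[𝓝[≠] 0] fun y : ℝ => |y| ^ N := by
    refine IsBigO.fun_sum (A := fun (k : ℕ) (y : ℝ) => (w k : ℂ) *
      (Complex.exp (Complex.I * (((r - k) * y : ℝ) : ℂ)) -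
        ∑ j ∈ Finset.range N, (Complex.I * (((r - k) * y : ℝ) : ℂ)) ^ j / (j.factorial : ℂ)))
      fun k _ => IsBigO.const_mul_left ?_ _
    have ht : Tendsto (fun y : ℝ => Complex.I * (((r - k) * y : ℝ) : ℂ)) (𝓝[≠] 0) (𝓝 0) :=
      tendsto_nhdsWithin_of_tendsto_nhds (by
        have : Continuous fun y : ℝ => Complex.I * (((r - k) * y : ℝ) : ℂ) := by fun_prop
        simpa using this.tendsto 0)
    refine ((Complex.exp_sub_sum_range_isBigO_pow N).comp_tendsto ht).trans
      (IsBigO.of_bound (|r - k| ^ N) (Eventually.of_forall fun y => ?_))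
    simp only [Function.comp_apply, norm_pow, norm_mul, Complex.norm_I, one_pow, one_mul, Complex.norm_real,
      Real.norm_eq_abs, abs_abs, mul_pow, le_refl]
  have h2 := eq_zero_of_isBigO_pow N (fun j => Complex.I ^ j *
    ((∑ k ∈ Finset.range M, w k * (r - k) ^ j / (j.factorial : ℝ) - c j : ℝ) : ℂ)) (by
      refine (h.sub hexp).congr_left fun y => ?_
      have hswap : ∑ k ∈ Finset.range M, (w k : ℂ) * ∑ j ∈ Finset.range N,
          (Complex.I * (((r - k) * y : ℝ) : ℂ)) ^ j / (j.factorial : ℂ) =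
          ∑ j ∈ Finset.range N, Complex.I ^ j * ((∑ k ∈ Finset.range M,
            w k * (r - k) ^ j / (j.factorial : ℝ) : ℝ) : ℂ) * (y : ℂ) ^ j := by
        simp only [Finset.mul_sum]
        rw [Finset.sum_comm]
        refine Finset.sum_congr rfl fun j _ => ?_
        push_cast
        rw [Finset.mul_sum, Finset.sum_mul]
        refine Finset.sum_congr rfl fun k _ => ?_
        rw [mul_pow, mul_pow]
        ring
      have e2 : ∑ j ∈ Finset.range N, Complex.I ^ j * ((∑ k ∈ Finset.range M,
          w k * (r - k) ^ j / (j.factorial : ℝ) - c j : ℝ) : ℂ) * (y : ℂ) ^ j =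
          ∑ j ∈ Finset.range N, Complex.I ^ j * ((∑ k ∈ Finset.range M,
            w k * (r - k) ^ j / (j.factorial : ℝ) : ℝ) : ℂ) * (y : ℂ) ^ j -
          ∑ j ∈ Finset.range N, (c j : ℂ) * (Complex.I * y) ^ j := by
        rw [← Finset.sum_sub_distrib]
        refine Finset.sum_congr rfl fun j _ => ?_
        rw [Complex.ofReal_sub, mul_pow]
        ring
      rw [e2, ← hswap]
      simp only [mul_sub, Finset.sum_sub_distrib]
      exact sub_sub_sub_cancel_left _ _ _) j hj
  have hI : Complex.I ^ j ≠ 0 := pow_ne_zero _ Complex.I_ne_zero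
  have h3 := (mul_eq_zero.1 h2).resolve_left hI
  have h4 := Complex.ofReal_eq_zero.1 h3
  linarith

theorem finite_diff_error {u : ℝ → ℝ} {w : ℕ → ℝ} {M N : ℕ} {r B : ℝ} {c : ℕ → ℝ} (hN : 0 < N)
    (hu : ContDiff ℝ ((N : ℕ) : ℕ∞) u) (hB : ∀ x, |iteratedDeriv N u x| ≤ B)
    (hc : ∀ j < N, ∑ k ∈ Finset.range M, w k * (r - k) ^ j / (j.factorial : ℝ) = c j)
    {h : ℝ} (hh : 0 < h) (x : ℝ) :
    |∑ k ∈ Finset.range M, w k * u (x - ((k : ℝ) - r) * h) -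
      ∑ j ∈ Finset.range N, c j * h ^ j * iteratedDeriv j u x| ≤
      (∑ k ∈ Finset.range M, |w k| * (B * |r - k| ^ N)) * h ^ N := by
  have e : ∑ k ∈ Finset.range M, w k * u (x - ((k : ℝ) - r) * h) -
      ∑ j ∈ Finset.range N, c j * h ^ j * iteratedDeriv j u x =
      ∑ k ∈ Finset.range M, w k * (u (x + (r - k) * h) -
        ∑ j ∈ Finset.range N, iteratedDeriv j u x * ((r - k) * h) ^ j / (j.factorial : ℝ)) := by
    simp only [mul_sub, Finset.sum_sub_distrib]
    congr 1
    · refine Finset.sum_congr rfl fun k _ => ?_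
      congr 2; ring
    · simp only [Finset.mul_sum]
      rw [Finset.sum_comm]
      refine Finset.sum_congr rfl fun j hj => ?_
      rw [← hc j (Finset.mem_range.1 hj), Finset.sum_mul, Finset.sum_mul]
      refine Finset.sum_congr rfl fun k _ => ?_
      rw [mul_pow]; ring
  rw [e, Finset.sum_mul]
  refine (Finset.abs_sum_le_sum_abs _ _).trans (Finset.sum_le_sum fun k _ => ?_)
  rw [abs_mul, mul_assoc]
  refine mul_le_mul_of_nonneg_left ((taylor_bound hN hu fun y _ => hB y).trans (le_of_eq ?_))
    (abs_nonneg _)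
  rw [abs_mul, abs_of_pos hh, mul_pow]
  ring

theorem integer_order_error {u : ℝ → ℝ} {n : ℕ} (hn : 0 < n) (r : ℝ)
    (hu : ContDiff ℝ ((n + 4 : ℕ) : ℕ∞) u)
    (hint : ∀ k ≤ n + 4, Integrable (iteratedDeriv k u)) :
    ∃ K, ∀ h : ℝ, 0 < h → ∀ x : ℝ,
      |leftDelta2 n r h u x - (iteratedDeriv n u x + a2 n r * h ^ 2 * iteratedDeriv (n + 2) u x)|
        ≤ K * h ^ 3 := by
  obtain ⟨M, hM⟩ := w2_natCast_eventually_zero n r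
  have hsupp : ∀ k ∉ Finset.range M, w2 n r k = 0 := fun k hk => hM k (by simpa using hk)
  -- The derivative of order `n + 3` is bounded because the next one is integrable. A Taylor
  -- remainder `h^(n+3)` suffices, since `h^n` is divided out.
  obtain ⟨B, hB⟩ := exists_bound_iteratedDeriv hu hint (k := n + 3) (by omega)
  have hn' : (0 : ℝ) < n := by exact_mod_cast hn
  obtain ⟨C, hC, hsym⟩ := w2Symbol_bound n r n hn' (Or.inr rfl)
  set c : ℕ → ℝ := fun j => if j = n then 1 else if j = n + 2 then a2 n r else 0 with hcdef
  -- Stated for a general ring map because it serves twice: over `ℂ` for the symbol and over `ℝ` for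
  -- the Taylor polynomial.
  have hcsum : ∀ {R : Type} [CommRing R] (φ : ℝ →+* R) (f : ℕ → R),
      ∑ j ∈ Finset.range (n + 3), φ (c j) * f j = f n + φ (a2 n r) * f (n + 2) := by
    intro R _ φ f
    rw [Finset.sum_range_succ, Finset.sum_range_succ, Finset.sum_range_succ, Finset.sum_eq_zero]
    · simp [hcdef]
    · intro j hj
      have := Finset.mem_range.1 hj
      simp [hcdef, show j ≠ n by omega, show j ≠ n + 2 by omega]
  have hmom : ∀ j < n + 3, ∑ k ∈ Finset.range M, w2 n r k * (r - k) ^ j / (j.factorial : ℝ) = c j := by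
    intro j hj
    refine moment_eq (N := n + 3) ?_ hj
    refine IsBigO.of_bound C (Eventually.of_forall fun y => ?_)
    have h1 := hsym y
    have h2 : diffSymbol (w2 n r) r y = ∑ k ∈ Finset.range M, (w2 n r k : ℂ) *
        Complex.exp (Complex.I * (((r - k) * y : ℝ) : ℂ)) :=
      tsum_eq_sum fun k hk => by simp [hsupp k hk]
    have h3 := hcsum Complex.ofRealHom fun j => (Complex.I * (y : ℂ)) ^ j
    simp only [Complex.ofRealHom_eq_coe] at h3
    rw [h3, ← h2, Real.norm_of_nonneg (by positivity)]
    refine (le_of_eq ?_).trans (h1.trans (le_of_eq ?_))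
    · rw [fracSymbol, Complex.ofReal_natCast, Complex.cpow_natCast]
      ring_nf
    · rw [Real.rpow_natCast]; ring
  refine ⟨∑ k ∈ Finset.range M, |w2 n r k| * (B * |r - k| ^ (n + 3)), fun h hh x => ?_⟩
  have herr := finite_diff_error (by omega) (hu.of_le (by exact_mod_cast (by omega : n + 3 ≤ n + 4)))
    hB hmom hh x
  have h4 := hcsum (RingHom.id ℝ) fun j => h ^ j * iteratedDeriv j u x
  simp only [RingHom.id_apply, ← mul_assoc] at h4
  rw [h4] at herr
  have h5 : ∑' k : ℕ, w2 n r k * u (x - ((k : ℝ) - r) * h) =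
      ∑ k ∈ Finset.range M, w2 n r k * u (x - ((k : ℝ) - r) * h) :=
    tsum_eq_sum fun k hk => by simp [hsupp k hk]
  have hhn : 0 < h ^ n := by positivity
  rw [leftDelta2, h5, Real.rpow_natCast]
  have h6 : 1 / h ^ n * ∑ k ∈ Finset.range M, w2 n r k * u (x - ((k : ℝ) - r) * h) -
      (iteratedDeriv n u x + a2 n r * h ^ 2 * iteratedDeriv (n + 2) u x) = 1 / h ^ n *
      (∑ k ∈ Finset.range M, w2 n r k * u (x - ((k : ℝ) - r) * h) -
      (h ^ n * iteratedDeriv n u x + a2 n r * h ^ (n + 2) * iteratedDeriv (n + 2) u x)) := by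
    generalize ∑ k ∈ Finset.range M, w2 n r k * u (x - ((k : ℝ) - r) * h) = S
    field_simp
    ring
  rw [h6, abs_mul, abs_of_pos (by positivity)]
  refine (mul_le_mul_of_nonneg_left herr (by positivity)).trans (le_of_eq ?_)
  generalize ∑ k ∈ Finset.range M, |w2 n r k| * (B * |r - k| ^ (n + 3)) = S
  rw [pow_add]
  field_simp

/-! ### The left-sided operators. -/

section Left

variable {u : ℝ → ℝ} {n : ℕ} {α : ℝ}

theorem leftGLQuotient_tendsto_complex (hα : 0 < α) (hαn : α ≤ n)
    (hu : ContDiff ℝ ((n + 4 : ℕ) : ℕ∞) u)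
    (hint : ∀ k ≤ n + 4, Integrable (iteratedDeriv k u)) (x : ℝ) :
    Tendsto (fun h => ((leftGLQuotient α h u x : ℝ) : ℂ)) (𝓝[>] (0 : ℝ))
      (𝓝 (fourierFracDeriv α u x)) := by
  obtain ⟨C, hC, hsym⟩ := glSymbol_bound α hα
  obtain ⟨K, hK⟩ := norm_diff_sub_le hu hint hα (by push_cast; linarith)
    (summable_abs_glWeight α hα) (r := 0) (a := 0) (m := 1) (C := C) (by push_cast; linarith)
    (by simpa using hsym)
  rw [tendsto_iff_norm_sub_tendsto_zero]
  have ht : Tendsto (fun h : ℝ => K * h ^ 1) (𝓝[>] (0 : ℝ)) (𝓝 0) :=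
    tendsto_nhdsWithin_of_tendsto_nhds (by
      have : Continuous fun h : ℝ => K * h ^ 1 := by fun_prop
      simpa using this.tendsto 0)
  refine squeeze_zero' (Eventually.of_forall fun _ => norm_nonneg _) ?_ ht
  filter_upwards [self_mem_nhdsWithin] with h hh
  simpa [leftGLQuotient] using hK h hh x

theorem leftGLQuotient_tendsto (hα : 0 < α) (hαn : α ≤ n)
    (hu : ContDiff ℝ ((n + 4 : ℕ) : ℕ∞) u)
    (hint : ∀ k ≤ n + 4, Integrable (iteratedDeriv k u)) (x : ℝ) :
    Tendsto (fun h => leftGLQuotient α h u x) (𝓝[>] (0 : ℝ)) (𝓝 (leftFracDeriv α u x)) := by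
  have h := (Complex.continuous_re.tendsto _).comp
    (leftGLQuotient_tendsto_complex hα hαn hu hint x)
  exact tendsto_nhds_limUnder ⟨_, h⟩

theorem ofReal_leftFracDeriv (hα : 0 < α) (hαn : α ≤ n)
    (hu : ContDiff ℝ ((n + 4 : ℕ) : ℕ∞) u)
    (hint : ∀ k ≤ n + 4, Integrable (iteratedDeriv k u)) :
    (fun x => ((leftFracDeriv α u x : ℝ) : ℂ)) = fourierFracDeriv α u :=
  funext fun x => tendsto_nhds_unique
    ((Complex.continuous_ofReal.tendsto _).comp (leftGLQuotient_tendsto hα hαn hu hint x))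
    (leftGLQuotient_tendsto_complex hα hαn hu hint x)

theorem contDiff_leftFracDeriv (hα : 0 < α) (hαn : α ≤ n)
    (hu : ContDiff ℝ ((n + 4 : ℕ) : ℕ∞) u)
    (hint : ∀ k ≤ n + 4, Integrable (iteratedDeriv k u)) :
    ContDiff ℝ 2 (leftFracDeriv α u) := by
  have h := (fourierFracDeriv_regularity hu hint hα (by push_cast; linarith)).1
  rw [← ofReal_leftFracDeriv hα hαn hu hint] at h
  exact Complex.reCLM.contDiff.comp h

/-- For integer order the symbol `(iy)^n` is that of the ordinary derivative, so Fourier inversion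
identifies the two. -/
theorem leftFracDeriv_natCast (hn : 0 < n)
    (hu : ContDiff ℝ ((n + 4 : ℕ) : ℕ∞) u)
    (hint : ∀ k ≤ n + 4, Integrable (iteratedDeriv k u)) :
    leftFracDeriv n u = iteratedDeriv n u := by
  have hn' : (0 : ℝ) < n := by exact_mod_cast hn
  have e : (fun ξ => fracSymbol n (2 * Real.pi * ξ) * fhat u ξ) = fhat (iteratedDeriv n u) := by
    funext ξ
    rw [fhat_iteratedDeriv hu hint (by omega), fracSymbol, Complex.ofReal_natCast,
      Complex.cpow_natCast]
  have hi : Integrable (fhat (iteratedDeriv n u)) := by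
    rw [← e]
    simpa using integrable_fracSymbol_mul_fhat hu hint hn' 0 (by push_cast; linarith)
  have hc : Continuous (iteratedDeriv n u) :=
    hu.continuous_iteratedDeriv n (by exact_mod_cast (by omega : n ≤ n + 4))
  have hinv := (Complex.continuous_ofReal.comp hc).fourierInv_fourier_eq
    (hint n (by omega)).ofReal hi
  funext x
  have h1 := congrFun (ofReal_leftFracDeriv hn' le_rfl hu hint) x
  rw [fourierFracDeriv, e] at h1
  have h2 := h1.trans (congrFun hinv x)
  exact Complex.ofReal_injective h2

theorem leftDelta2_error (hα : 0 < α) (hαn : α ≤ n) {r : ℝ} (hr : r ≤ α ∨ α = n)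
    (hu : ContDiff ℝ ((n + 4 : ℕ) : ℕ∞) u)
    (hint : ∀ k ≤ n + 4, Integrable (iteratedDeriv k u)) :
    ∃ K, ∀ h : ℝ, 0 < h → ∀ x : ℝ,
      |leftDelta2 α r h u x - Px α r h (leftFracDeriv α u) x| ≤ K * h ^ 3 := by
  -- The Fourier estimate with `m = 3` needs `α + 4 < n + 4`, so the endpoint `α = n` goes through
  -- the Taylor argument.
  rcases hαn.lt_or_eq with hlt | rfl
  · obtain ⟨C, hC, hsym⟩ := w2Symbol_bound α r n hα hr
    obtain ⟨K, hK⟩ := norm_diff_sub_le hu hint hα (by push_cast; linarith)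
      (exists_w2_spec α r n hα hr).1 (by push_cast; linarith) hsym
    refine ⟨K, fun h hh x => ?_⟩
    have h1 := hK h hh x
    rw [← ofReal_leftFracDeriv hα hαn hu hint, iteratedDeriv_ofReal_comp (N := 2)
      (by exact_mod_cast contDiff_leftFracDeriv hα hαn hu hint) le_rfl] at h1
    rw [leftDelta2, Px, ← Real.norm_eq_abs, ← Complex.norm_real]
    push_cast at h1 ⊢
    exact h1
  · have hn : 0 < n := by exact_mod_cast hα
    obtain ⟨K, hK⟩ := integer_order_error hn r hu hint
    refine ⟨K, fun h hh x => ?_⟩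
    have h2 : iteratedDeriv 2 (iteratedDeriv n u) = iteratedDeriv (n + 2) u := by
      rw [iteratedDeriv_eq_iterate, iteratedDeriv_eq_iterate, iteratedDeriv_eq_iterate,
        ← Function.iterate_add_apply, add_comm 2 n]
    rw [Px, leftFracDeriv_natCast hn hu hint, h2]
    exact hK h hh x

theorem summable_mul_comp {w : ℕ → ℝ} (hw : Summable fun k => |w k|) {M : ℝ}
    (hM : ∀ x, |u x| ≤ M) (t : ℕ → ℝ) : Summable fun k => w k * u (t k) := by
  refine Summable.of_norm_bounded (hw.mul_right M) fun k => ?_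
  rw [norm_mul, Real.norm_eq_abs, Real.norm_eq_abs]
  gcongr
  exact hM _

end Left

/-! ### Reflection to the right-sided operators. -/

theorem rightGLQuotient_eq (α h : ℝ) (u : ℝ → ℝ) (x : ℝ) :
    rightGLQuotient α h u x = leftGLQuotient α h (fun y => u (-y)) (-x) := by
  simp only [rightGLQuotient, leftGLQuotient]
  congr 1
  refine tsum_congr fun k => ?_
  congr 2
  ring

theorem rightFracDeriv_eq (α : ℝ) (u : ℝ → ℝ) (x : ℝ) :
    rightFracDeriv α u x = leftFracDeriv α (fun y => u (-y)) (-x) := by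
  simp only [rightFracDeriv, leftFracDeriv, rightGLQuotient_eq]

theorem rightDelta2_eq (α r h : ℝ) (u : ℝ → ℝ) (x : ℝ) :
    rightDelta2 α r h u x = leftDelta2 α r h (fun y => u (-y)) (-x) := by
  simp only [rightDelta2, leftDelta2]
  congr 1
  refine tsum_congr fun k => ?_
  congr 2
  ring

theorem Px_comp_neg (α r h : ℝ) (v : ℝ → ℝ) (x : ℝ) :
    Px α r h (fun y => v (-y)) x = Px α r h v (-x) := by
  simp [Px, iteratedDeriv_comp_neg]

/-! ### Comparison of `P_h` with `P_x`. -/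

/-- Adding the expansions at `x + h` and `x - h` cancels the odd terms. Each leaves a remainder of
at most `M h^4`, whence the factor `2 * M`. -/
theorem Ph_sub_Px_le (α r : ℝ) {v : ℝ → ℝ} (hv : ContDiff ℝ 4 v) {x h M : ℝ} (hh : 0 < h)
    (hM : ∀ y ∈ Set.Icc (x - h) (x + h), |iteratedDeriv 4 v y| ≤ M) :
    |Ph α r h v x - Px α r h v x| ≤ |a2 α r| * (2 * M) * h ^ 4 := by
  have hv' : ContDiff ℝ ((4 : ℕ) : ℕ∞) v := by exact_mod_cast hv
  have h1 := taylor_bound (x := x) (t := h) (by norm_num) hv' fun y hy => hM y (by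
    rw [Set.uIcc_of_le (by linarith)] at hy
    exact ⟨by linarith [hy.1], hy.2⟩)
  have h2 := taylor_bound (x := x) (t := -h) (by norm_num) hv' fun y hy => hM y (by
    rw [Set.uIcc_of_ge (by linarith)] at hy
    exact ⟨by linarith [hy.1], by linarith [hy.2]⟩)
  simp only [Finset.sum_range_succ, Finset.sum_range_zero, Nat.factorial] at h1 h2
  norm_num at h1 h2
  rw [abs_of_pos hh] at h1 h2
  rw [show (-h) ^ 3 = -h ^ 3 by ring] at h2
  have e : Ph α r h v x - Px α r h v x = a2 α r *
      (v (x + h) + v (x + -h) - 2 * v x - h ^ 2 * iteratedDeriv 2 v x) := by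
    rw [Ph, Px, centralDiff2, ← sub_eq_add_neg]
    field_simp
    ring
  rw [e, abs_mul, mul_assoc]
  refine mul_le_mul_of_nonneg_left ?_ (abs_nonneg _)
  rw [abs_le] at h1 h2 ⊢
  constructor <;> linarith [h1.1, h1.2, h2.1, h2.2]

theorem Ph_sub_Px_isBigO (α r : ℝ) {v : ℝ → ℝ} (hv : ContDiff ℝ 4 v) (x : ℝ) :
    (fun h => Ph α r h v x - Px α r h v x) =O[𝓝[>] (0 : ℝ)] fun h => h ^ 4 := by
  have hc : Continuous (iteratedDeriv 4 v) := hv.continuous_iteratedDeriv 4 le_rfl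
  obtain ⟨M, hM⟩ := (isCompact_Icc (a := x - 1) (b := x + 1)).exists_bound_of_continuousOn
    hc.continuousOn
  refine IsBigO.of_bound (|a2 α r| * (2 * M)) ?_
  -- For `h < 1` the stencil stays in `[x - 1, x + 1]`, where the fourth derivative is bounded by
  -- compactness.
  filter_upwards [Ioo_mem_nhdsGT (zero_lt_one (α := ℝ))] with h hh
  rw [Real.norm_of_nonneg (pow_nonneg hh.1.le 4)]
  exact Ph_sub_Px_le α r hv hh.1 fun y hy =>
    hM y ⟨by linarith [hy.1, hh.2], by linarith [hy.2, hh.2]⟩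

end QuasiCompact

end

/-! ### Assembly of the theorem. -/

theorem mainTheorem3 (α r : ℝ) (n : ℕ) (hα : 0 < α) (hn : (n : ℝ) - 1 < α) (hn' : α ≤ n)
    (hr : r ≤ α ∨ α = n) :
    -- the power series of the generating function converges absolutely on the closed unit disc
    (Summable fun k : ℕ => |QuasiCompact.w2 α r k|) ∧
    -- third order approximation of the left and right fractional derivatives
    (∀ u : ℝ → ℝ, ContDiff ℝ ((n + 4 : ℕ) : ℕ∞) u →
      (∀ k : ℕ, k ≤ n + 4 → MeasureTheory.Integrable (iteratedDeriv k u)) →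
      ((∀ h : ℝ, 0 < h → ∀ x : ℝ,
          (Summable fun k : ℕ => QuasiCompact.glWeight α k * u (x - k * h)) ∧
          (Summable fun k : ℕ => QuasiCompact.w2 α r k * u (x - ((k : ℝ) - r) * h))) ∧
        (∀ x : ℝ, Tendsto (fun h => QuasiCompact.leftGLQuotient α h u x) (𝓝[>] (0 : ℝ))
          (𝓝 (QuasiCompact.leftFracDeriv α u x))) ∧
        ContDiff ℝ 2 (QuasiCompact.leftFracDeriv α u) ∧
        ∃ C h₀ : ℝ, 0 < h₀ ∧ ∀ h : ℝ, 0 < h → h ≤ h₀ → ∀ x : ℝ,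
          |QuasiCompact.leftDelta2 α r h u x -
            QuasiCompact.Px α r h (QuasiCompact.leftFracDeriv α u) x| ≤ C * h ^ 3) ∧
      ((∀ h : ℝ, 0 < h → ∀ x : ℝ,
          (Summable fun k : ℕ => QuasiCompact.glWeight α k * u (x + k * h)) ∧
          (Summable fun k : ℕ => QuasiCompact.w2 α r k * u (x + ((k : ℝ) - r) * h))) ∧
        (∀ x : ℝ, Tendsto (fun h => QuasiCompact.rightGLQuotient α h u x) (𝓝[>] (0 : ℝ))
          (𝓝 (QuasiCompact.rightFracDeriv α u x))) ∧
        ContDiff ℝ 2 (QuasiCompact.rightFracDeriv α u) ∧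
        ∃ C h₀ : ℝ, 0 < h₀ ∧ ∀ h : ℝ, 0 < h → h ≤ h₀ → ∀ x : ℝ,
          |QuasiCompact.rightDelta2 α r h u x -
            QuasiCompact.Px α r h (QuasiCompact.rightFracDeriv α u) x| ≤ C * h ^ 3)) ∧
    -- fourth order approximation of `P_x` by `P_h`
    (∀ v : ℝ → ℝ, ContDiff ℝ 4 v →
      (∀ x : ℝ, (fun h => QuasiCompact.Ph α r h v x - QuasiCompact.Px α r h v x)
        =O[𝓝[>] (0 : ℝ)] fun h => h ^ 4) ∧
      ((∃ M : ℝ, ∀ x : ℝ, |iteratedDeriv 4 v x| ≤ M) →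
        ∃ C : ℝ, ∀ h : ℝ, 0 < h → ∀ x : ℝ,
          |QuasiCompact.Ph α r h v x - QuasiCompact.Px α r h v x| ≤ C * h ^ 4)) := by
  obtain ⟨hw, -⟩ := QuasiCompact.exists_w2_spec α r n hα hr
  have hg := QuasiCompact.summable_abs_glWeight α hα
  refine ⟨hw, fun u hu hint => ⟨?_, ?_⟩, fun v hv =>
    ⟨fun x => QuasiCompact.Ph_sub_Px_isBigO α r hv x, ?_⟩⟩
  · obtain ⟨M, hM⟩ := QuasiCompact.exists_bound_iteratedDeriv hu hint (k := 0) (by omega)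
    simp only [iteratedDeriv_zero] at hM
    obtain ⟨K, hK⟩ := QuasiCompact.leftDelta2_error hα hn' hr hu hint
    exact ⟨fun h _ x => ⟨QuasiCompact.summable_mul_comp hg hM _,
      QuasiCompact.summable_mul_comp hw hM _⟩,
      -- The threshold `h₀ = 1` is arbitrary: the error bound holds for every `h > 0`.
      QuasiCompact.leftGLQuotient_tendsto hα hn' hu hint,
      QuasiCompact.contDiff_leftFracDeriv hα hn' hu hint, K, 1, one_pos, fun h hh _ => hK h hh⟩
  · obtain ⟨M, hM⟩ := QuasiCompact.exists_bound_iteratedDeriv hu hint (k := 0) (by omega)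
    simp only [iteratedDeriv_zero] at hM
    have hu' : ContDiff ℝ ((n + 4 : ℕ) : ℕ∞) fun y => u (-y) := hu.comp contDiff_neg
    have hint' : ∀ k ≤ n + 4, MeasureTheory.Integrable (iteratedDeriv k fun y => u (-y)) := by
      intro k hk
      have : (iteratedDeriv k fun y => u (-y)) = fun y => (-1) ^ k * iteratedDeriv k u (-y) := by
        funext y; rw [iteratedDeriv_comp_neg, smul_eq_mul]
      rw [this]
      exact (hint k hk).comp_neg.const_mul _
    have hR : QuasiCompact.rightFracDeriv α u =
        fun x => QuasiCompact.leftFracDeriv α (fun y => u (-y)) (-x) :=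
      funext (QuasiCompact.rightFracDeriv_eq α u)
    obtain ⟨K, hK⟩ := QuasiCompact.leftDelta2_error hα hn' hr hu' hint'
    refine ⟨fun h _ x => ⟨QuasiCompact.summable_mul_comp hg hM _,
      QuasiCompact.summable_mul_comp hw hM _⟩, fun x => ?_, ?_, K, 1, one_pos,
      fun h hh _ x => ?_⟩
    · simp only [QuasiCompact.rightGLQuotient_eq, QuasiCompact.rightFracDeriv_eq]
      exact QuasiCompact.leftGLQuotient_tendsto hα hn' hu' hint' (-x)
    · rw [hR]
      exact (QuasiCompact.contDiff_leftFracDeriv hα hn' hu' hint').comp contDiff_neg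
    · rw [hR, QuasiCompact.Px_comp_neg, QuasiCompact.rightDelta2_eq]
      exact hK h hh (-x)
  · rintro ⟨M, hM⟩
    exact ⟨_, fun h hh x => QuasiCompact.Ph_sub_Px_le α r hv hh fun y _ => hM y⟩
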